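/- Regularized Unconstrained Submodular Maximization (RUSM) is the following problem: given a finite ground set $\mathcal N$, a non-negative submodular function $g\colon 2^{\mathcal N}\to\mathbb R_{\ge 0}$ and a linear function $\ell\colon 2^{\mathcal N}\to\mathbb R$ (that is, $\ell(S)=\sum_{u\in S}a_u$ for real numbers $a_u$ of arbitrary signs), both accessible only through value oracles (a query to the oracle of $f$ with a set $S$ returns $f(S)$), find a set $T\subseteq\mathcal N$ maximizing $g(T)+\ell(T)$. For $a,b\ge 0$, a (randomized) algorithm is an $(a,b)$-approximation algorithm for RUSM if on every input its output $T\subseteq\mathcal N$ satisfies $$\mathbb E[g(T)+\ell(T)]\ \ge\ \max_{S\subseteq\mathcal N}\,[a\cdot g(S)+b\cdot \ell(S)].$$ For $\beta\in(0,1]$ let $\alpha(\beta)=\beta(1-\beta)/(1+\beta)$. Theorem. For every constant $\beta\in(0,1]$ and every constant $\varepsilon\in(0,\alpha(\beta))$ there is a polynomial-time $(\alpha(\beta)-\varepsilon,\ \beta-\varepsilon)$-approximation algorithm for RUSM. Here an algorithm is a randomized program built with branches and counted loops (possibly depending on $\beta$ and $\varepsilon$, but not on $\mathcal N$, $g$ or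 $\ell$) for a random access machine in which one step is an elementary operation on natural numbers (addition, truncated subtraction, comparison), a conversion of a natural number to a real number, a load or store (possibly with indirect addressing), an arithmetic operation or comparison on real numbers, the insertion, removal or membership test of one element in a stored set, a value-oracle query, or a fair coin flip; polynomial time means that, on every input and for all outcomes of the coin flips, the number of steps is at most $p(|\mathcal N|)$ for a fixed polynomial $p$. -/

import Mathlib

noncomputable section

namespace RUSM

/-! ### The problem -/

/-- Diminishing returns: the marginal contribution of `u` to `S` is at least its marginal
contribution to any larger set `T` that does not contain `u`. -/
def IsSubmodular {n : ℕ} (f : Finset (Fin n) → ℝ) : Prop :=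
  ∀ S T : Finset (Fin n), S ⊆ T → ∀ u, u ∉ T → f (insert u T) - f T ≤ f (insert u S) - f S

/-- A set function is linear if it sums fixed (real, possibly negative) element weights. -/
def IsLinear {n : ℕ} (f : Finset (Fin n) → ℝ) : Prop :=
  ∃ a : Fin n → ℝ, ∀ S, f S = ∑ u ∈ S, a u

/-- An instance of Regularized Unconstrained Submodular Maximization whose ground set has
`n` elements, numbered `0, …, n - 1`. -/
structure Inst (n : ℕ) where
  g : Finset (Fin n) → ℝ
  l : Finset (Fin n) → ℝ
  g_nonneg : ∀ S, 0 ≤ g S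
  g_submodular : IsSubmodular g
  l_linear : IsLinear l

/-! ### The machine model

Randomized programs for a unit-cost random access machine over the reals. The memory consists of
registers for natural numbers, registers for real numbers, and registers for subsets of the ground
set (bit arrays, which can only be changed one element at a time). The functions `g` and `l` of the
input are accessible only by value-oracle queries. Programs are finite pieces of syntax that do not
depend on `n` and mention only natural and rational constants; the randomness consists of
independent fair coin flips. Natural numbers are not multiplied in one step and reals are not
rounded, so that unit costs do not hide long computations. All loops are counted loops, which makes
every program halt; this only restricts the programs that are available. -/

/-- Contents of the memory, for a ground set with `n` elements. -/
structure State (n : ℕ) where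
  nat : ℕ → ℕ
  real : ℕ → ℝ
  set : ℕ → Finset (Fin n)

/-- Deterministic elementary instructions. The first argument is the target register, except in
the indirect stores, where the first argument holds the number of the target register. -/
inductive Instr : Type
  | natConst (x k : ℕ)
  | natAdd (x y z : ℕ)
  | natSub (x y z : ℕ)
  | natLoad (x p : ℕ)
  | natStore (p y : ℕ)
  | realConst (x : ℕ) (q : ℚ)
  | realOfNat (x y : ℕ)
  | realAdd (x y z : ℕ)
  | realSub (x y z : ℕ)
  | realMul (x y z : ℕ)
  | realDiv (x y z : ℕ)
  | realLoad (x p : ℕ)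
  | realStore (p y : ℕ)
  | setInsert (s i : ℕ)
  | setErase (s i : ℕ)
  | queryG (x s : ℕ)
  | queryL (x s : ℕ)

/-- Conditions that can be tested in one step. -/
inductive Test : Type
  | natLE (x y : ℕ)
  | realLE (x y : ℕ)
  | mem (i s : ℕ)

/-- Programs. `flip x` writes a fair random bit to the natural register `x`; `loop x c` executes
`c` as many times as the number that natural register `x` holds when the loop is entered. -/
inductive Program : Type
  | skip
  | instr (i : Instr)
  | flip (x : ℕ)
  | seq (c d : Program)
  | ite (t : Test) (c d : Program)
  | loop (x : ℕ) (c : Program)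

namespace State

variable {n : ℕ}

def setNat (σ : State n) (x v : ℕ) : State n := { σ with nat := Function.update σ.nat x v }

def setReal (σ : State n) (x : ℕ) (v : ℝ) : State n :=
  { σ with real := Function.update σ.real x v }

def setSet (σ : State n) (s : ℕ) (v : Finset (Fin n)) : State n :=
  { σ with set := Function.update σ.set s v }

/-- The start of a computation: natural register `0` holds the size of the ground set, all other
registers are zero or empty. -/
def init (n : ℕ) : State n where
  nat := Function.update (fun _ => 0) 0 n
  real := fun _ => 0
  set := fun _ => ∅

end State

/-- The effect of an elementary instruction. Subtraction of natural numbers is truncated at zero,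
a quotient with divisor zero is zero, and inserting or erasing a number that is not the number of
an element of the ground set has no effect. -/
def Instr.run {n : ℕ} (I : Inst n) (σ : State n) : Instr → State n
  | .natConst x k => σ.setNat x k
  | .natAdd x y z => σ.setNat x (σ.nat y + σ.nat z)
  | .natSub x y z => σ.setNat x (σ.nat y - σ.nat z)
  | .natLoad x p => σ.setNat x (σ.nat (σ.nat p))
  | .natStore p y => σ.setNat (σ.nat p) (σ.nat y)
  | .realConst x q => σ.setReal x (q : ℝ)
  | .realOfNat x y => σ.setReal x (σ.nat y : ℝ)
  | .realAdd x y z => σ.setReal x (σ.real y + σ.real z)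
  | .realSub x y z => σ.setReal x (σ.real y - σ.real z)
  | .realMul x y z => σ.setReal x (σ.real y * σ.real z)
  | .realDiv x y z => σ.setReal x (σ.real y / σ.real z)
  | .realLoad x p => σ.setReal x (σ.real (σ.nat p))
  | .realStore p y => σ.setReal (σ.nat p) (σ.real y)
  | .setInsert s i =>
      if h : σ.nat i < n then σ.setSet s (insert ⟨σ.nat i, h⟩ (σ.set s)) else σ
  | .setErase s i =>
      if h : σ.nat i < n then σ.setSet s ((σ.set s).erase ⟨σ.nat i, h⟩) else σ
  | .queryG x s => σ.setReal x (I.g (σ.set s))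
  | .queryL x s => σ.setReal x (I.l (σ.set s))

/-- The outcome of a test. -/
def Test.Holds {n : ℕ} (σ : State n) : Test → Prop
  | .natLE x y => σ.nat x ≤ σ.nat y
  | .realLE x y => σ.real x ≤ σ.real y
  | .mem i s => ∃ h : σ.nat i < n, (⟨σ.nat i, h⟩ : Fin n) ∈ σ.set s

/-- Repeat a randomized, step-counting computation `k` times; every check of the loop counter
costs one step. -/
def iterate {n : ℕ} (f : State n → PMF (State n × ℕ)) : ℕ → State n → PMF (State n × ℕ)
  | 0, σ => PMF.pure (σ, 1)
  | k + 1, σ => (f σ).bind fun r => (iterate f k r.1).map fun r' => (r'.1, r.2 + r'.2 + 1)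

namespace Program

open Classical in
/-- The joint distribution of the final memory and the number of executed steps. Every elementary
instruction (in particular every oracle query), coin flip, test and check of a loop counter is one
step. -/
def exec {n : ℕ} (I : Inst n) : Program → State n → PMF (State n × ℕ)
  | skip, σ => PMF.pure (σ, 0)
  | instr i, σ => PMF.pure (i.run I σ, 1)
  | flip x, σ => (PMF.uniformOfFintype Bool).map fun b => (σ.setNat x b.toNat, 1)
  | seq c d, σ => (exec I c σ).bind fun r => (exec I d r.1).map fun r' => (r'.1, r.2 + r'.2)
  | ite t c d, σ =>
      (if t.Holds σ then exec I c σ else exec I d σ).map fun r => (r.1, r.2 + 1)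
  | loop x c, σ => iterate (exec I c) (σ.nat x) σ

/-- The distribution of the output, which is the final content of set register `0`. -/
def output (P : Program) {n : ℕ} (I : Inst n) : PMF (Finset (Fin n)) :=
  (P.exec I (State.init n)).map fun r => r.1.set 0

/-- The expectation `𝔼[g(T) + ℓ(T)]` for the output `T`. -/
def expectedValue (P : Program) {n : ℕ} (I : Inst n) : ℝ :=
  ∑ T : Finset (Fin n), (P.output I T).toReal * (I.g T + I.l T)

/-- On every input, and whatever the coin flips are, the number of steps is at most a fixed
polynomial in the size of the ground set. -/
def IsPolynomialTime (P : Program) : Prop :=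
  ∃ p : Polynomial ℕ, ∀ (n : ℕ) (I : Inst n),
    ∀ r ∈ (P.exec I (State.init n)).support, r.2 ≤ p.eval n

/-- `(a, b)`-approximation: `𝔼[g(T) + ℓ(T)] ≥ max_S [a g(S) + b ℓ(S)]` on every input. -/
def IsApproximation (P : Program) (a b : ℝ) : Prop :=
  ∀ (n : ℕ) (I : Inst n),
    Finset.univ.sup' Finset.univ_nonempty (fun S : Finset (Fin n) => a * I.g S + b * I.l S)
      ≤ P.expectedValue I

end Program

/-- The coefficient `α(β) = β(1 - β)/(1 + β)`. -/
def alpha (β : ℝ) : ℝ := β * (1 - β) / (1 + β)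

end RUSM

end

noncomputable section

namespace RUSM

/-! ### Submodular functions -/

namespace IsSubmodular

variable {n : ℕ} {f : Finset (Fin n) → ℝ}

theorem union_sub_le (hf : IsSubmodular f) {X Y : Finset (Fin n)} (h : X ⊆ Y)
    (C : Finset (Fin n)) (hC : Disjoint C Y) : f (Y ∪ C) - f Y ≤ f (X ∪ C) - f X := by
  induction C using Finset.induction_on with
  | empty => simp
  | insert u C hu ih =>
    rw [Finset.disjoint_insert_left] at hC
    have h1 := ih hC.2
    have h2 := hf (X ∪ C) (Y ∪ C) (Finset.union_subset_union_left h) u (by simp [hC.1, hu])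
    rw [Finset.union_insert, Finset.union_insert]
    linarith

theorem union_add_inter_le (hf : IsSubmodular f) (X Y : Finset (Fin n)) :
    f (X ∪ Y) + f (X ∩ Y) ≤ f X + f Y := by
  have h := hf.union_sub_le (X := X ∩ Y) (Y := X) Finset.inter_subset_left (Y \ X)
    Finset.sdiff_disjoint
  have e1 : X ∪ Y \ X = X ∪ Y := by simp
  have e2 : X ∩ Y ∪ Y \ X = Y := by ext; simp; tauto
  rw [e1, e2] at h
  linarith

theorem union_sub_le_sum (hf : IsSubmodular f) (R C : Finset (Fin n)) :
    f (R ∪ C) - f R ≤ ∑ u ∈ C, (f (insert u R) - f R) := by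
  induction C using Finset.induction_on with
  | empty => simp
  | insert u C hu ih =>
    rw [Finset.sum_insert hu]
    have h2 : f (insert u (R ∪ C)) - f (R ∪ C) ≤ f (insert u R) - f R := by
      by_cases h : u ∈ R
      · simp [h, Finset.insert_eq_of_mem]
      · exact hf _ _ Finset.subset_union_left u (by simp [h, hu])
    rw [Finset.union_insert]
    linarith

theorem sum_erase_le (hf : IsSubmodular f) (R C : Finset (Fin n)) (hC : C ⊆ R) :
    ∑ u ∈ C, (f R - f (R.erase u)) ≤ f R - f (R \ C) := by
  induction C using Finset.induction_on with
  | empty => simp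
  | insert u C hu ih =>
    rw [Finset.sum_insert hu]
    have huR : u ∈ R := hC (Finset.mem_insert_self _ _)
    have h1 := ih ((Finset.subset_insert _ _).trans hC)
    have h2 := hf (R \ insert u C) (R.erase u) (by
      intro v; simp; tauto) u (by simp)
    rw [Finset.insert_erase huR] at h2
    have e : insert u (R \ insert u C) = R \ C := by
      ext v
      simp only [Finset.mem_insert, Finset.mem_sdiff]
      by_cases hv : v = u
      · subst hv; simp [huR, hu]
      · simp [hv]
    rw [e] at h2
    linarith

theorem le_empty_add_sum (hf : IsSubmodular f) (R : Finset (Fin n)) :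
    f R ≤ f ∅ + ∑ u ∈ R, (f {u} - f ∅) := by
  have := hf.union_sub_le_sum ∅ R
  simp only [Finset.empty_union, insert_empty_eq] at this
  linarith

theorem inter_left (hf : IsSubmodular f) (S : Finset (Fin n)) :
    IsSubmodular fun R => f (R ∩ S) := by
  intro X Y h u hu
  by_cases hS : u ∈ S
  · simp only [Finset.insert_inter_of_mem hS]
    exact hf _ _ (Finset.inter_subset_inter_right h) u (by simp [hu])
  · simp [Finset.insert_inter_of_notMem hS]

theorem union_left (hf : IsSubmodular f) (S : Finset (Fin n)) :
    IsSubmodular fun R => f (R ∪ S) := by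
  intro X Y h u hu
  by_cases hS : u ∈ S
  · simp [Finset.insert_union, hS]
  · simp only [Finset.insert_union]
    exact hf _ _ (Finset.union_subset_union_left h) u (by simp [hu, hS])

end IsSubmodular

/-! ### Independent sampling and the multilinear extension -/

variable {n : ℕ}

/-- The expectation of `f` after independently resampling the membership of every element of a
list, where `u` becomes a member with probability `x u`. -/
def resample (x : Fin n → ℝ) : List (Fin n) → (Finset (Fin n) → ℝ) → Finset (Fin n) → ℝ
  | [], f, R => f R
  | u :: s, f, R => x u * resample x s f (insert u R) + (1 - x u) * resample x s f (R.erase u)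

theorem resample_congr_start (x : Fin n → ℝ) (f : Finset (Fin n) → ℝ) (L : List (Fin n))
    (R R' : Finset (Fin n)) (h : ∀ u, u ∉ L → (u ∈ R ↔ u ∈ R')) :
    resample x L f R = resample x L f R' := by
  induction L generalizing R R' with
  | nil =>
    have : R = R' := by ext u; exact h u (by simp)
    rw [this]
  | cons v s ih =>
    simp only [resample]
    rw [ih (insert v R) (insert v R'), ih (R.erase v) (R'.erase v)]
    · intro u hu
      by_cases huv : u = v
      · simp [huv]
      · simpa [huv] using h u (by simp [huv, hu])
    · intro u hu
      by_cases huv : u = v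
      · simp [huv]
      · simpa [huv] using h u (by simp [huv, hu])

theorem resample_congr_prob {x x' : Fin n → ℝ} (f : Finset (Fin n) → ℝ) (L : List (Fin n))
    (R : Finset (Fin n)) (h : ∀ u ∈ L, x u = x' u) : resample x L f R = resample x' L f R := by
  induction L generalizing R with
  | nil => rfl
  | cons v s ih =>
    simp only [resample]
    rw [ih _ fun u hu => h u (by simp [hu]), ih _ fun u hu => h u (by simp [hu]),
      h v (by simp)]

theorem resample_add (x : Fin n → ℝ) (f g : Finset (Fin n) → ℝ) (L : List (Fin n))
    (R : Finset (Fin n)) :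
    resample x L (fun R => f R + g R) R = resample x L f R + resample x L g R := by
  induction L generalizing R with
  | nil => rfl
  | cons v s ih => simp only [resample, ih]; ring

theorem resample_mul (x : Fin n → ℝ) (c : ℝ) (f : Finset (Fin n) → ℝ) (L : List (Fin n))
    (R : Finset (Fin n)) : resample x L (fun R => c * f R) R = c * resample x L f R := by
  induction L generalizing R with
  | nil => rfl
  | cons v s ih => simp only [resample, ih]; ring

theorem resample_const (x : Fin n → ℝ) (c : ℝ) (L : List (Fin n)) (R : Finset (Fin n)) :
    resample x L (fun _ => c) R = c := by
  induction L generalizing R with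
  | nil => rfl
  | cons v s ih => simp only [resample, ih]; ring

theorem resample_mono {x : Fin n → ℝ} (h0 : ∀ u, 0 ≤ x u) (h1 : ∀ u, x u ≤ 1)
    {N : Finset (Fin n)} (hN : ∀ u, u ∉ N → x u = 0) {f g : Finset (Fin n) → ℝ}
    (hfg : ∀ R, R ⊆ N → f R ≤ g R) (L : List (Fin n)) (R : Finset (Fin n)) (hR : R ⊆ N) :
    resample x L f R ≤ resample x L g R := by
  induction L generalizing R with
  | nil => exact hfg R hR
  | cons v s ih =>
    simp only [resample]
    have e := ih (R.erase v) ((Finset.erase_subset _ _).trans hR)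
    by_cases hv : v ∈ N
    · have i := ih (insert v R) (Finset.insert_subset hv hR)
      have := mul_le_mul_of_nonneg_left i (h0 v)
      have := mul_le_mul_of_nonneg_left e (sub_nonneg.2 (h1 v))
      linarith
    · simpa [hN v hv] using e

theorem resample_update (x : Fin n → ℝ) (f : Finset (Fin n) → ℝ) (L : List (Fin n))
    (hL : L.Nodup) (u : Fin n) (t : ℝ) (R : Finset (Fin n)) :
    resample (Function.update x u t) L f R =
      t * resample (Function.update x u 1) L f R
        + (1 - t) * resample (Function.update x u 0) L f R := by
  induction L generalizing R with
  | nil => simp only [resample]; ring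
  | cons v s ih =>
    rw [List.nodup_cons] at hL
    by_cases hv : v = u
    · subst hv
      have key : ∀ a b R', resample (Function.update x v a) s f R' =
          resample (Function.update x v b) s f R' := fun a b R' =>
        resample_congr_prob f s R' fun w hw => by
          have : w ≠ v := fun h => hL.1 (h ▸ hw)
          simp [this]
      simp only [resample, Function.update_self]
      rw [key t 1, key t 1, key 0 1, key 0 1]
      ring
    · simp only [resample, Function.update_of_ne hv]
      rw [ih hL.2, ih hL.2 (R.erase v)]
      ring

/-- The expectation of `f` at a random set containing each `u` independently with probability
`x u`, that is, the multilinear extension of `f`. -/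
def ext (x : Fin n → ℝ) (f : Finset (Fin n) → ℝ) : ℝ := resample x (List.finRange n) f ∅

theorem resample_finRange (x : Fin n → ℝ) (f : Finset (Fin n) → ℝ) (R : Finset (Fin n)) :
    resample x (List.finRange n) f R = ext x f :=
  resample_congr_start _ _ _ _ _ fun u hu => absurd (List.mem_finRange u) hu

/-- The indicator vector of a set. -/
def vertex (A : Finset (Fin n)) : Fin n → ℝ := fun u => if u ∈ A then 1 else 0

theorem resample_vertex (A : Finset (Fin n)) (f : Finset (Fin n) → ℝ) (L : List (Fin n))
    (R : Finset (Fin n)) (h : ∀ u, u ∉ L → (u ∈ R ↔ u ∈ A)) :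
    resample (vertex A) L f R = f A := by
  induction L generalizing R with
  | nil =>
    have : R = A := by ext u; exact h u (by simp)
    simp [resample, this]
  | cons v s ih =>
    simp only [resample, vertex]
    by_cases hv : v ∈ A
    · simp only [hv, if_true, sub_self, zero_mul, add_zero, one_mul]
      refine ih _ fun u hu => ?_
      by_cases huv : u = v
      · simp [huv, hv]
      · simpa [huv] using h u (by simp [huv, hu])
    · simp only [hv, if_false, sub_zero, zero_mul, zero_add, one_mul]
      refine ih _ fun u hu => ?_
      by_cases huv : u = v
      · simp [huv, hv]
      · simpa [huv] using h u (by simp [huv, hu])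

theorem ext_vertex (A : Finset (Fin n)) (f : Finset (Fin n) → ℝ) : ext (vertex A) f = f A :=
  resample_vertex _ _ _ _ fun u hu => absurd (List.mem_finRange u) hu

theorem ext_add (x : Fin n → ℝ) (f g : Finset (Fin n) → ℝ) :
    ext x (fun R => f R + g R) = ext x f + ext x g := resample_add ..

theorem ext_mul (x : Fin n → ℝ) (c : ℝ) (f : Finset (Fin n) → ℝ) :
    ext x (fun R => c * f R) = c * ext x f := resample_mul ..

theorem ext_const (x : Fin n → ℝ) (c : ℝ) : ext x (fun _ => c) = c := resample_const ..

theorem ext_sub (x : Fin n → ℝ) (f g : Finset (Fin n) → ℝ) :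
    ext x (fun R => f R - g R) = ext x f - ext x g := by
  have := ext_add x (fun R => f R - g R) g
  simp only [sub_add_cancel] at this
  linarith

theorem ext_sum {ι : Type*} (x : Fin n → ℝ) (s : Finset ι) (f : ι → Finset (Fin n) → ℝ) :
    ext x (fun R => ∑ i ∈ s, f i R) = ∑ i ∈ s, ext x (f i) := by
  classical
  induction s using Finset.induction_on with
  | empty => simpa using ext_const x 0
  | insert i s hi ih => simp only [Finset.sum_insert hi, ext_add, ih]

theorem ext_mono {x : Fin n → ℝ} (h0 : ∀ u, 0 ≤ x u) (h1 : ∀ u, x u ≤ 1)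
    {N : Finset (Fin n)} (hN : ∀ u, u ∉ N → x u = 0) {f g : Finset (Fin n) → ℝ}
    (hfg : ∀ R, R ⊆ N → f R ≤ g R) : ext x f ≤ ext x g :=
  resample_mono h0 h1 hN hfg _ _ (Finset.empty_subset _)

theorem ext_update (x : Fin n → ℝ) (f : Finset (Fin n) → ℝ) (u : Fin n) (t : ℝ) :
    ext (Function.update x u t) f =
      t * ext (Function.update x u 1) f + (1 - t) * ext (Function.update x u 0) f :=
  resample_update _ _ _ (List.nodup_finRange n) _ _ _

/-- Functions of a real vector that are affine in every coordinate. -/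
def MultiAffine (Θ : (Fin n → ℝ) → ℝ) : Prop :=
  ∀ w u t, Θ (Function.update w u t) =
    t * Θ (Function.update w u 1) + (1 - t) * Θ (Function.update w u 0)

namespace MultiAffine

theorem ext (f : Finset (Fin n) → ℝ) : MultiAffine fun x => ext x f :=
  fun x u t => ext_update x f u t

theorem ext_mul (f : Finset (Fin n) → ℝ) (p : ℝ) :
    MultiAffine fun w => RUSM.ext (fun u => p * w u) f := by
  intro w u t
  have e : ∀ s, (fun v => p * Function.update w u s v) =
      Function.update (fun v => p * w v) u (p * s) := by
    intro s; funext v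
    by_cases h : v = u
    · subst h; simp
    · simp [h]
  simp only [e, mul_zero, mul_one]
  rw [ext_update _ _ _ (p * t), ext_update _ _ _ p]
  ring

theorem add {Θ Λ : (Fin n → ℝ) → ℝ} (h : MultiAffine Θ) (h' : MultiAffine Λ) :
    MultiAffine fun w => Θ w + Λ w := by
  intro w u t
  simp only [h w u t, h' w u t]
  ring

theorem const_mul {Θ : (Fin n → ℝ) → ℝ} (h : MultiAffine Θ) (c : ℝ) :
    MultiAffine fun w => c * Θ w := by
  intro w u t
  simp only [h w u t]
  ring

theorem const (c : ℝ) : MultiAffine fun _ : Fin n → ℝ => c := by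
  intro w u t
  ring

theorem sum {ι : Type*} (s : Finset ι) {Θ : ι → (Fin n → ℝ) → ℝ} (h : ∀ i, MultiAffine (Θ i)) :
    MultiAffine fun w => ∑ i ∈ s, Θ i w := by
  classical
  induction s using Finset.induction_on with
  | empty => simpa using const 0
  | insert i s hi ih => simp only [Finset.sum_insert hi]; exact (h i).add ih

/-- A multi-affine function may be multiplied by an affine function of a coordinate that it does
not depend on. -/
theorem affine_mul {Θ : (Fin n → ℝ) → ℝ} (h : MultiAffine Θ) (u : Fin n)
    (hu : ∀ w t, Θ (Function.update w u t) = Θ w) (c : ℝ) :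
    MultiAffine fun w => (c - w u) * Θ w := by
  intro w v t
  by_cases hv : v = u
  · subst hv
    simp only [hu, Function.update_self]
    ring
  · have hv' : u ≠ v := fun h => hv h.symm
    simp only [Function.update_of_ne hv', h w v t]
    ring

theorem vertex_induction {P : (Fin n → ℝ) → Prop} (hA : ∀ A, P (vertex A))
    (step : ∀ w u, P (Function.update w u 1) → P (Function.update w u 0) → P w)
    (w : Fin n → ℝ) : P w := by
  suffices key : ∀ s : Finset (Fin n), ∀ w : Fin n → ℝ, (∀ u, u ∉ s → w u = 0 ∨ w u = 1) → P w from
    key Finset.univ w fun u hu => absurd (Finset.mem_univ u) hu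
  intro s
  induction s using Finset.induction_on with
  | empty =>
    intro w hw
    have : w = vertex (Finset.univ.filter fun u => w u = 1) := by
      funext u
      rcases hw u (by simp) with h | h <;> simp [vertex, h]
    rw [this]
    exact hA _
  | insert u s hu ih =>
    intro w hw
    have hh : ∀ t : ℝ, t = 0 ∨ t = 1 → P (Function.update w u t) := by
      intro t ht
      apply ih
      intro v hvs
      by_cases hv : v = u
      · subst hv; simpa using ht
      · simpa [hv] using hw v (by simp [hv, hvs])
    exact step w u (hh 1 (Or.inr rfl)) (hh 0 (Or.inl rfl))

theorem eq_update {Θ : (Fin n → ℝ) → ℝ} (h : MultiAffine Θ) (w : Fin n → ℝ) (u : Fin n) :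
    Θ w = w u * Θ (Function.update w u 1) + (1 - w u) * Θ (Function.update w u 0) := by
  rw [← h w u (w u), Function.update_eq_self]

theorem nonneg {Θ : (Fin n → ℝ) → ℝ} (h : MultiAffine Θ) (hA : ∀ A, 0 ≤ Θ (vertex A))
    (w : Fin n → ℝ) (h0 : ∀ u, 0 ≤ w u) (h1 : ∀ u, w u ≤ 1) : 0 ≤ Θ w := by
  refine vertex_induction (P := fun w => (∀ u, 0 ≤ w u ∧ w u ≤ 1) → 0 ≤ Θ w) (fun A _ => hA A)
    (fun w u i1 i0 hw => ?_) w fun u => ⟨h0 u, h1 u⟩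
  have hh : ∀ t : ℝ, 0 ≤ t → t ≤ 1 →
      ∀ v, 0 ≤ Function.update w u t v ∧ Function.update w u t v ≤ 1 := by
    intro t h0 h1 v
    by_cases hv : v = u
    · subst hv; simp [h0, h1]
    · simpa [hv] using hw v
  have a := mul_nonneg (hw u).1 (i1 (hh 1 zero_le_one le_rfl))
  have b := mul_nonneg (sub_nonneg.2 (hw u).2) (i0 (hh 0 le_rfl zero_le_one))
  rw [h.eq_update w u]
  linarith

theorem ext_of_vertex {Θ Λ : (Fin n → ℝ) → ℝ} (h : MultiAffine Θ) (h' : MultiAffine Λ)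
    (hA : ∀ A, Θ (vertex A) = Λ (vertex A)) (w : Fin n → ℝ) : Θ w = Λ w := by
  refine vertex_induction (P := fun w => Θ w = Λ w) hA (fun w u i1 i0 => ?_) w
  rw [h.eq_update w u, h'.eq_update w u, i1, i0]

theorem update_const {Θ : (Fin n → ℝ) → ℝ} (h : MultiAffine Θ) (u : Fin n) (s : ℝ) :
    MultiAffine fun w => Θ (Function.update w u s) := by
  intro w v t
  by_cases hv : v = u
  · subst hv
    simp only [Function.update_idem]
    ring
  · simp only [Function.update_comm hv, h (Function.update w u s) v t]

end MultiAffine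

theorem ext_insert (x : Fin n → ℝ) (f : Finset (Fin n) → ℝ) (u : Fin n) :
    ext x (fun R => f (insert u R)) = ext (Function.update x u 1) f := by
  refine MultiAffine.ext_of_vertex (MultiAffine.ext _) ((MultiAffine.ext f).update_const u 1)
    (fun A => ?_) x
  have : Function.update (vertex A) u 1 = vertex (insert u A) := by
    funext v
    by_cases hv : v = u
    · subst hv; simp [vertex]
    · simp [hv, vertex]
  simp only [this, ext_vertex]

theorem ext_erase (x : Fin n → ℝ) (f : Finset (Fin n) → ℝ) (u : Fin n) :
    ext x (fun R => f (R.erase u)) = ext (Function.update x u 0) f := by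
  refine MultiAffine.ext_of_vertex (MultiAffine.ext _) ((MultiAffine.ext f).update_const u 0)
    (fun A => ?_) x
  have : Function.update (vertex A) u 0 = vertex (A.erase u) := by
    funext v
    by_cases hv : v = u
    · subst hv; simp [vertex]
    · simp [hv, vertex]
  simp only [this, ext_vertex]

/-- Conditioning on whether `u` is in the random set. -/
theorem ext_cond (x : Fin n → ℝ) (f : Finset (Fin n) → ℝ) (u : Fin n) :
    ext x f = x u * ext x (fun R => f (insert u R)) + (1 - x u) * ext x (fun R => f (R.erase u)) := by
  rw [ext_insert, ext_erase]
  exact (MultiAffine.ext f).eq_update x u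

/-- The discrete derivative of `f` in the direction of `u`. -/
def marg (f : Finset (Fin n) → ℝ) (u : Fin n) (R : Finset (Fin n)) : ℝ :=
  f (insert u R) - f (R.erase u)

theorem ext_marg (x : Fin n → ℝ) (f : Finset (Fin n) → ℝ) (u : Fin n) :
    ext x (marg f u) = ext (Function.update x u 1) f - ext (Function.update x u 0) f := by
  rw [← ext_insert, ← ext_erase, ← ext_sub]; rfl

theorem ext_marg_update (x : Fin n → ℝ) (f : Finset (Fin n) → ℝ) (u : Fin n) (t : ℝ) :
    ext (Function.update x u t) (marg f u) = ext x (marg f u) := by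
  rw [ext_marg, ext_marg]; simp

theorem ext_mul_marg (x : Fin n → ℝ) (f : Finset (Fin n) → ℝ) (u : Fin n) :
    x u * ext x (marg f u) = ext x fun R => if u ∈ R then f R - f (R.erase u) else 0 := by
  rw [ext_cond x (fun R => if u ∈ R then f R - f (R.erase u) else 0) u]
  simp only [Finset.mem_insert_self, if_true, Finset.notMem_erase, if_false, ext_const, mul_zero,
    add_zero, Finset.erase_insert_eq_erase]
  rfl

/-- The multilinear extension of a submodular function is concave along `p ↦ p • 1_A`, so it lies
above the chord. -/
theorem chord_le_resample {f : Finset (Fin n) → ℝ} (hf : IsSubmodular f) {p : ℝ} (h0 : 0 ≤ p)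
    (h1 : p ≤ 1) (A : Finset (Fin n)) (L : List (Fin n)) (hL : L.Nodup) (R : Finset (Fin n))
    (hR : ∀ u ∈ L, u ∉ R) :
    (1 - p) * f R + p * f (R ∪ L.toFinset ∩ A) ≤ resample (fun u => p * vertex A u) L f R := by
  induction L generalizing R with
  | nil => simp [resample]; linarith
  | cons v s ih =>
    rw [List.nodup_cons] at hL
    simp only [resample]
    rw [Finset.erase_eq_of_notMem (hR v (by simp))]
    have i0 := ih hL.2 R fun u hu => hR u (by simp [hu])
    by_cases hv : v ∈ A
    · have i1 := ih hL.2 (insert v R) fun u hu => by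
        have : u ≠ v := fun h => hL.1 (h ▸ hu)
        simp [this, hR u (by simp [hu])]
      have hs := hf.union_add_inter_le (insert v R) (R ∪ s.toFinset ∩ A)
      have e1 : insert v R ∩ (R ∪ s.toFinset ∩ A) = R := by
        ext u
        by_cases huv : u = v
        · subst huv; simp [hL.1]
        · simp [huv]; tauto
      have e2 : insert v R ∪ (R ∪ s.toFinset ∩ A) = R ∪ (v :: s).toFinset ∩ A := by
        ext u
        by_cases huv : u = v
        · subst huv; simp [hv]
        · simp [huv]
      have e3 : insert v R ∪ s.toFinset ∩ A = R ∪ (v :: s).toFinset ∩ A := by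
        ext u
        by_cases huv : u = v
        · subst huv; simp [hv]
        · simp [huv]
      rw [e1, e2] at hs
      rw [e3] at i1
      have hvx : vertex A v = 1 := by simp [vertex, hv]
      rw [hvx, mul_one]
      have a := mul_le_mul_of_nonneg_left i1 h0
      have b := mul_le_mul_of_nonneg_left i0 (sub_nonneg.2 h1)
      have c := mul_le_mul_of_nonneg_left hs (mul_nonneg h0 (sub_nonneg.2 h1))
      nlinarith
    · have hvx : vertex A v = 0 := by simp [vertex, hv]
      have e : (v :: s).toFinset ∩ A = s.toFinset ∩ A := by
        ext u
        by_cases huv : u = v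
        · subst huv; simp [hv]
        · simp [huv]
      rw [hvx, e]
      linarith

theorem chord_le_ext {f : Finset (Fin n) → ℝ} (hf : IsSubmodular f) {p : ℝ} (h0 : 0 ≤ p)
    (h1 : p ≤ 1) (A : Finset (Fin n)) :
    (1 - p) * f ∅ + p * f A ≤ ext (fun u => p * vertex A u) f := by
  have := chord_le_resample hf h0 h1 A (List.finRange n) (List.nodup_finRange n) ∅ (by simp)
  have e : (List.finRange n).toFinset = Finset.univ := by ext; simp
  simpa [e, ext] using this

/-! ### The variational inequality -/

/-- The linearised comparison of a set `A` with a set `S`, when the elements of `A` are sampled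
with probability `p`. -/
theorem comparison_vertex {g : Finset (Fin n) → ℝ} (hg : IsSubmodular g) (hg0 : ∀ S, 0 ≤ g S)
    {p : ℝ} (h0 : 0 ≤ p) (h1 : p ≤ 1) (S A : Finset (Fin n)) :
    p * (1 - p) * g S ≤
      ∑ u, p * (vertex S u - vertex A u) * ext (fun v => p * vertex A v) (marg g u)
        + (1 + p) * ext (fun v => p * vertex A v) g := by
  set q : Fin n → ℝ := fun v => p * vertex A v with hq
  have q0 : ∀ u, 0 ≤ q u := fun u => by simp only [hq, vertex]; split_ifs <;> simp [h0]
  have q1 : ∀ u, q u ≤ 1 := fun u => by simp only [hq, vertex]; split_ifs <;> simp [h1]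
  have qA : ∀ u, u ∉ A → q u = 0 := fun u hu => by simp [hq, vertex, hu]
  have term : ∀ u, p * (vertex S u - vertex A u) * ext q (marg g u) =
      p * (if u ∈ S \ A then ext q (marg g u) else 0)
        - (if u ∈ A \ S then q u * ext q (marg g u) else 0) := by
    intro u
    by_cases hS : u ∈ S <;> by_cases hA : u ∈ A <;> simp [vertex, hS, hA, hq]
  simp only [term, ext_mul_marg, Finset.sum_sub_distrib, ← Finset.mul_sum]
  rw [Finset.sum_ite_mem, Finset.sum_ite_mem, Finset.univ_inter, Finset.univ_inter,
    ← ext_sum, ← ext_sum, ← ext_mul, ← ext_mul, ← ext_sub, ← ext_add]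
  have c1 := chord_le_ext (hg.inter_left S) h0 h1 A
  have c2 := chord_le_ext (hg.union_left S) h0 h1 A
  have low : p * ext q (fun R => g (R ∪ S)) + ext q (fun R => g (R ∩ S)) - p * g (A ∩ S) ≤
      ext q fun R => p * ∑ u ∈ S \ A, marg g u R
        - ∑ u ∈ A \ S, (if u ∈ R then g R - g (R.erase u) else 0) + (1 + p) * g R := by
    rw [← ext_mul, ← ext_add, ← ext_const q (p * g (A ∩ S)), ← ext_sub]
    refine ext_mono q0 q1 qA fun R hR => ?_
    have i1 := hg.union_sub_le_sum R (S \ A)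
    have e1 : ∑ u ∈ S \ A, marg g u R = ∑ u ∈ S \ A, (g (insert u R) - g R) := by
      refine Finset.sum_congr rfl fun u hu => ?_
      rw [Finset.mem_sdiff] at hu
      rw [marg, Finset.erase_eq_of_notMem fun h => hu.2 (hR h)]
    have i2 := hg.sum_erase_le R (R \ S) Finset.sdiff_subset
    have e2 : ∑ u ∈ A \ S, (if u ∈ R then g R - g (R.erase u) else 0) =
        ∑ u ∈ R \ S, (g R - g (R.erase u)) := by
      rw [Finset.sum_ite_mem]
      refine Finset.sum_congr ?_ fun _ _ => rfl
      ext u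
      simp only [Finset.mem_inter, Finset.mem_sdiff]
      exact ⟨fun h => ⟨h.2, h.1.2⟩, fun h => ⟨⟨hR h.1, h.2⟩, h.1⟩⟩
    have i3 := hg.union_add_inter_le (R ∪ S \ A) (A ∩ S)
    have e3 : R ∪ S \ A ∪ A ∩ S = R ∪ S := by ext u; simp; tauto
    have e4 : (R ∪ S \ A) ∩ (A ∩ S) = R ∩ S := by
      ext u; have := @hR u; simp; tauto
    rw [e3, e4] at i3
    rw [sdiff_sdiff_right_self, Finset.inf_eq_inter] at i2
    rw [e1, e2]
    have := mul_le_mul_of_nonneg_left i1 h0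
    have := mul_le_mul_of_nonneg_left i3 h0
    have := mul_nonneg h0 (hg0 (R ∩ S))
    linarith
  refine le_trans ?_ low
  simp only [Finset.empty_inter, Finset.empty_union] at c1 c2
  have := mul_nonneg (sub_nonneg.2 h1) (hg0 ∅)
  have := mul_le_mul_of_nonneg_left c2 h0
  have := mul_nonneg h0 (mul_nonneg h0 (hg0 (A ∪ S)))
  linarith

/-- The variational inequality: comparison of a fractional point with a set `S`. -/
theorem comparison {g : Finset (Fin n) → ℝ} (hg : IsSubmodular g) (hg0 : ∀ S, 0 ≤ g S)
    {p : ℝ} (h0 : 0 < p) (h1 : p ≤ 1) (S : Finset (Fin n)) {x : Fin n → ℝ} (hx0 : ∀ u, 0 ≤ x u)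
    (hxp : ∀ u, x u ≤ p) :
    p * (1 - p) * g S ≤
      ∑ u, (p * vertex S u - x u) * ext x (marg g u) + (1 + p) * ext x g := by
  have key := MultiAffine.nonneg (Θ := fun w =>
    ∑ u, p * ((vertex S u - w u) * ext (fun v => p * w v) (marg g u))
      + (1 + p) * ext (fun v => p * w v) g + -(p * (1 - p) * g S))
    (((MultiAffine.sum _ fun u => MultiAffine.const_mul
      ((MultiAffine.ext_mul _ p).affine_mul u (fun w t => ?_) _) p).add
      ((MultiAffine.ext_mul g p).const_mul _)).add (MultiAffine.const _)) (fun A => ?_)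
    (fun u => x u / p) (fun u => div_nonneg (hx0 u) h0.le) (fun u => (div_le_one h0).2 (hxp u))
  · have e : (fun v => p * (x v / p)) = x := by funext v; field_simp
    simp only [e] at key
    have e2 : ∀ u, p * ((vertex S u - x u / p) * ext x (marg g u)) =
        (p * vertex S u - x u) * ext x (marg g u) := by intro u; field_simp
    simp only [e2] at key
    linarith
  · have e : (fun v => p * Function.update w u t v) =
        Function.update (fun v => p * w v) u (p * t) := by
      funext v
      by_cases h : v = u
      · subst h; simp
      · simp [h]
    rw [e, ext_marg_update]
  · have := comparison_vertex hg hg0 h0.le h1 S A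
    simp only [← mul_assoc]
    linarith

theorem ext_linear (x a : Fin n → ℝ) : ext x (fun R => ∑ u ∈ R, a u) = ∑ u, x u * a u := by
  have e : (fun R : Finset (Fin n) => ∑ u ∈ R, a u) =
      fun R => ∑ u, if u ∈ R then a u else 0 := by
    funext R; simp
  rw [e, ext_sum]
  refine Finset.sum_congr rfl fun u _ => ?_
  rw [ext_cond x _ u]
  simp [ext_const]

/-! ### Online gradient ascent -/

section Ascent

variable (g : Finset (Fin n) → ℝ) (a : Fin n → ℝ) (p : ℝ)

/-- The unbiased estimate, from a sample `R`, of a partial derivative of the objective. -/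
def grad (u : Fin n) (R : Finset (Fin n)) : ℝ := marg g u R + (1 + p) * a u

/-- The objective of the problem. -/
def objective (R : Finset (Fin n)) : ℝ := g R + ∑ u ∈ R, a u

/-- One projected ascent step with step size `r` in the box `[0, p]ⁿ`. -/
def ascend (r : ℝ) (x : Fin n → ℝ) (R : Finset (Fin n)) : Fin n → ℝ :=
  fun u => min p (max 0 (x u + r * grad g a p u R))

/-- Rounding down to multiples of `1 / T` on `N`, and to zero elsewhere. -/
def roundDown (N : Finset (Fin n)) (T : ℕ) (x : Fin n → ℝ) : Fin n → ℝ :=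
  fun u => if u ∈ N then (⌊x u * T⌋₊ : ℝ) / T else 0

/-- The potential function: weighted squared distance from `p • 1_S`. -/
def potential (N S : Finset (Fin n)) (c : ℝ) (x : Fin n → ℝ) : ℝ :=
  c * ∑ u ∈ N, (p * vertex S u - x u) ^ 2

variable {g a p}

theorem ascend_mem (h0 : 0 ≤ p) (r : ℝ) (x : Fin n → ℝ) (R : Finset (Fin n)) (u : Fin n) :
    0 ≤ ascend g a p r x R u ∧ ascend g a p r x R u ≤ p :=
  ⟨le_min h0 (le_max_left _ _), min_le_left _ _⟩

theorem sq_sub_clip_le {y : ℝ} (hy0 : 0 ≤ y) (hyp : y ≤ p) (z : ℝ) :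
    (y - min p (max 0 z)) ^ 2 ≤ (y - z) ^ 2 := by
  rcases le_total z 0 with h | h
  · rw [max_eq_left h, min_eq_right (hy0.trans hyp)]
    nlinarith
  · rw [max_eq_right h]
    rcases le_total p z with h' | h'
    · rw [min_eq_left h']; nlinarith
    · rw [min_eq_right h']

theorem coordinate_step {D M y x G : ℝ} (hD : 0 ≤ D) (hM : 0 < M) (hy0 : 0 ≤ y) (hyp : y ≤ p)
    (hG : |G| ≤ 2 * D) :
    (y - x) * G ≤ D * M / 2 * ((y - x) ^ 2 - (y - min p (max 0 (x + 1 / (D * M) * G))) ^ 2)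
      + 2 * D / M := by
  rcases hD.eq_or_lt with rfl | hD
  · have : G = 0 := by simpa using hG
    simp [this]
  · have h1 := sq_sub_clip_le hy0 hyp (x + 1 / (D * M) * G)
    have h2 : G ^ 2 ≤ (2 * D) ^ 2 := sq_le_sq' (neg_le_of_abs_le hG) (le_of_abs_le hG)
    have h3 : D * M / 2 * ((y - x) ^ 2 - (y - (x + 1 / (D * M) * G)) ^ 2) =
        (y - x) * G - G ^ 2 / (2 * (D * M)) := by field_simp; ring
    have h4 : G ^ 2 / (2 * (D * M)) ≤ 2 * D / M := by
      rw [div_le_div_iff₀ (by positivity) hM]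
      nlinarith [mul_le_mul_of_nonneg_left h2 hM.le]
    have h5 := mul_le_mul_of_nonneg_left h1 (by positivity : 0 ≤ D * M / 2)
    linarith

theorem roundDown_bounds {N : Finset (Fin n)} {T : ℕ} (hT : 0 < T) {x : Fin n → ℝ}
    (hx : ∀ u, 0 ≤ x u) (u : Fin n) :
    0 ≤ roundDown N T x u ∧ roundDown N T x u ≤ x u ∧
      (u ∈ N → x u - roundDown N T x u ≤ 1 / T) := by
  have hT' : (0 : ℝ) < T := by exact_mod_cast hT
  unfold roundDown
  split_ifs with h
  · have h1 := Nat.floor_le (mul_nonneg (hx u) hT'.le)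
    have h2 := (Nat.lt_floor_add_one (x u * T)).le
    refine ⟨by positivity, (div_le_iff₀ hT').2 h1, fun _ => ?_⟩
    rw [sub_le_iff_le_add, ← add_div, le_div_iff₀ hT']
    linarith
  · exact ⟨le_rfl, hx u, fun h' => absurd h' h⟩

theorem step_bound (hg : IsSubmodular g) (hg0 : ∀ S, 0 ≤ g S) (h0 : 0 < p) (h1 : p ≤ 1)
    {S N : Finset (Fin n)} (hS : S ⊆ N) {D M : ℝ} (hD : 0 ≤ D) (hM : 0 < M) {T : ℕ} (hT : 0 < T)
    (hG : ∀ u ∈ N, ∀ R, R ⊆ N → |grad g a p u R| ≤ 2 * D)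
    {x : Fin n → ℝ} (hx0 : ∀ u, 0 ≤ x u) (hxp : ∀ u, x u ≤ p) :
    p * (1 - p) * g S + (1 + p) * (p * ∑ u ∈ S, a u) - n * (2 * D / M + 2 * D / T)
        - potential p N S (D * M / 2) x
        + ext (roundDown N T x)
          (fun R => potential p N S (D * M / 2) (ascend g a p (1 / (D * M)) x R))
      ≤ (1 + p) * ext (roundDown N T x) (objective g a) := by
  set z := roundDown N T x with hz
  have hzb := fun u => roundDown_bounds (N := N) hT hx0 u
  have z0 : ∀ u, 0 ≤ z u := fun u => (hzb u).1
  have zp : ∀ u, z u ≤ p := fun u => (hzb u).2.1.trans (hxp u)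
  have z1 : ∀ u, z u ≤ 1 := fun u => (zp u).trans h1
  have zN : ∀ u, u ∉ N → z u = 0 := fun u hu => by simp [hz, roundDown, hu]
  have hcmp := comparison hg hg0 h0 h1 S z0 zp
  have hobj : ext z (objective g a) = ext z g + ∑ u, z u * a u := by
    rw [← ext_linear, ← ext_add]; rfl
  have hgrad : ∀ u, ext z (grad g a p u) = ext z (marg g u) + (1 + p) * a u := by
    intro u
    rw [← ext_const z ((1 + p) * a u), ← ext_add]; rfl
  have hsum : ∑ u, (p * vertex S u - z u) * ext z (grad g a p u) =
      ∑ u, (p * vertex S u - z u) * ext z (marg g u)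
        + (1 + p) * (p * ∑ u ∈ S, a u) - (1 + p) * ∑ u, z u * a u := by
    have e : ∑ u ∈ S, a u = ∑ u, vertex S u * a u := by simp [vertex]
    rw [e]
    simp only [hgrad, Finset.mul_sum, ← Finset.sum_add_distrib, ← Finset.sum_sub_distrib]
    refine Finset.sum_congr rfl fun u _ => by ring
  have hN : ∑ u, (p * vertex S u - z u) * ext z (grad g a p u) =
      ∑ u ∈ N, (p * vertex S u - z u) * ext z (grad g a p u) := by
    refine (Finset.sum_subset (Finset.subset_univ N) fun u _ hu => ?_).symm
    have : u ∉ S := fun h => hu (hS h)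
    simp [zN u hu, vertex, this]
  have hy : ∀ u, 0 ≤ p * vertex S u ∧ p * vertex S u ≤ p := fun u => by
    unfold vertex; split_ifs <;> simp [h0.le]
  have hterm : ∀ u ∈ N, (p * vertex S u - z u) * ext z (grad g a p u) ≤
      ext z (fun R => D * M / 2 * ((p * vertex S u - x u) ^ 2
        - (p * vertex S u - ascend g a p (1 / (D * M)) x R u) ^ 2))
        + (2 * D / M + 2 * D / T) := by
    intro u hu
    have t1 : ext z (fun R => (p * vertex S u - x u) * grad g a p u R) ≤
        ext z (fun R => D * M / 2 * ((p * vertex S u - x u) ^ 2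
        - (p * vertex S u - ascend g a p (1 / (D * M)) x R u) ^ 2) + 2 * D / M) :=
      ext_mono z0 z1 zN fun R hR => coordinate_step hD hM (hy u).1 (hy u).2 (hG u hu R hR)
    rw [ext_mul, ext_add, ext_const] at t1
    have t2 : ext z (grad g a p u) ≤ 2 * D := by
      rw [← ext_const z (2 * D)]
      exact ext_mono z0 z1 zN fun R hR => le_of_abs_le (hG u hu R hR)
    have t3 : (x u - z u) * ext z (grad g a p u) ≤ 1 / T * (2 * D) :=
      (mul_le_mul_of_nonneg_left t2 (sub_nonneg.2 (hzb u).2.1)).trans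
        (mul_le_mul_of_nonneg_right ((hzb u).2.2 hu) (by positivity))
    have e : 1 / (T : ℝ) * (2 * D) = 2 * D / T := by ring
    linarith
  have hfinal := Finset.sum_le_sum hterm
  rw [Finset.sum_add_distrib, ← ext_sum, Finset.sum_const, nsmul_eq_mul] at hfinal
  have hpot : ext z (fun R => ∑ u ∈ N, D * M / 2 * ((p * vertex S u - x u) ^ 2
        - (p * vertex S u - ascend g a p (1 / (D * M)) x R u) ^ 2)) =
      potential p N S (D * M / 2) x - ext z (fun R =>
        potential p N S (D * M / 2) (ascend g a p (1 / (D * M)) x R)) := by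
    rw [← ext_const z (potential p N S (D * M / 2) x), ← ext_sub]
    congr 1
    funext R
    simp only [potential, ← Finset.mul_sum, Finset.sum_sub_distrib, mul_sub]
  have hcard : (N.card : ℝ) * (2 * D / M + 2 * D / T) ≤ n * (2 * D / M + 2 * D / T) := by
    refine mul_le_mul_of_nonneg_right ?_ (by positivity)
    exact_mod_cast (Finset.card_le_univ N).trans (by simp)
  rw [hobj]
  linarith

variable (g a p) in
/-- The expected value of the output after `t` further ascent steps from `x`. -/
def ascentValue (N : Finset (Fin n)) (T : ℕ) (r : ℝ) : ℕ → (Fin n → ℝ) → ℝ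
  | 0, x => ext (roundDown N T x) (objective g a)
  | t + 1, x => ext (roundDown N T x) fun R => ascentValue N T r t (ascend g a p r x R)

theorem sum_ascentValue_ge (hg : IsSubmodular g) (hg0 : ∀ S, 0 ≤ g S) (h0 : 0 < p) (h1 : p ≤ 1)
    {S N : Finset (Fin n)} (hS : S ⊆ N) {D M : ℝ} (hD : 0 ≤ D) (hM : 0 < M) {T : ℕ} (hT : 0 < T)
    (hG : ∀ u ∈ N, ∀ R, R ⊆ N → |grad g a p u R| ≤ 2 * D) (k : ℕ)
    {x : Fin n → ℝ} (hx0 : ∀ u, 0 ≤ x u) (hxp : ∀ u, x u ≤ p) :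
    k * (p * (1 - p) * g S + (1 + p) * (p * ∑ u ∈ S, a u) - n * (2 * D / M + 2 * D / T))
        - potential p N S (D * M / 2) x
      ≤ (1 + p) * ∑ t ∈ Finset.range k, ascentValue g a p N T (1 / (D * M)) t x := by
  induction k generalizing x with
  | zero =>
    have : 0 ≤ potential p N S (D * M / 2) x :=
      mul_nonneg (by positivity) (Finset.sum_nonneg fun u _ => sq_nonneg _)
    simpa using this
  | succ k ih =>
    have hs := step_bound hg hg0 h0 h1 hS hD hM hT hG hx0 hxp
    rw [Finset.sum_range_succ']
    simp only [ascentValue]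
    set z := roundDown N T x with hz
    set C := p * (1 - p) * g S + (1 + p) * (p * ∑ u ∈ S, a u) - n * (2 * D / M + 2 * D / T)
      with hC
    have hzb := fun u => roundDown_bounds (N := N) hT hx0 u
    have key : ext z (fun R => k * C - potential p N S (D * M / 2)
        (ascend g a p (1 / (D * M)) x R)) ≤ ext z (fun R => (1 + p) * ∑ t ∈ Finset.range k,
          ascentValue g a p N T (1 / (D * M)) t (ascend g a p (1 / (D * M)) x R)) :=
      ext_mono (N := Finset.univ) (fun u => (hzb u).1)
        (fun u => ((hzb u).2.1.trans (hxp u)).trans h1) (fun u hu => absurd (Finset.mem_univ u) hu)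
        fun R _ => ih (fun u => (ascend_mem h0.le _ x R u).1) (fun u => (ascend_mem h0.le _ x R u).2)
    rw [ext_sub, ext_const, ext_mul, ext_sum] at key
    push_cast
    linarith

end Ascent

/-! ### The guarantee of the ascent -/

section Guarantee

variable {n : ℕ} (g : Finset (Fin n) → ℝ) (a : Fin n → ℝ) (ρ : ℝ)

open Classical in
/-- The elements whose addition to the empty set increases `ρ • g + ℓ`. -/
def useful : Finset (Fin n) := Finset.univ.filter fun u => 0 < ρ * (g {u} - g ∅) + a u

/-- The scale of the partial derivatives. -/
def scale : ℝ := g ∅ + ∑ u ∈ useful g a ρ, (3 * g {u} + a u)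

variable {g a ρ}

theorem mem_useful {u : Fin n} : u ∈ useful g a ρ ↔ 0 < ρ * (g {u} - g ∅) + a u := by
  simp [useful]

theorem le_inter_useful (hg : IsSubmodular g) (hρ : 0 ≤ ρ) (S : Finset (Fin n)) :
    ρ * g S + ∑ u ∈ S, a u ≤
      ρ * g (S ∩ useful g a ρ) + ∑ u ∈ S ∩ useful g a ρ, a u := by
  set N := useful g a ρ
  have h1 := hg.union_sub_le_sum (S ∩ N) (S \ N)
  have e1 : S ∩ N ∪ S \ N = S := by ext u; simp; tauto
  have h2 : ∑ u ∈ S \ N, (g (insert u (S ∩ N)) - g (S ∩ N)) ≤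
      ∑ u ∈ S \ N, (g {u} - g ∅) := by
    refine Finset.sum_le_sum fun u hu => ?_
    have := hg ∅ (S ∩ N) (Finset.empty_subset _) u (by
      simp only [Finset.mem_sdiff] at hu; simp [hu.2])
    simpa using this
  have h3 : ∑ u ∈ S \ N, (ρ * (g {u} - g ∅) + a u) ≤ 0 := by
    refine Finset.sum_nonpos fun u hu => ?_
    simp only [Finset.mem_sdiff] at hu
    exact not_lt.1 fun h => hu.2 (mem_useful.2 h)
  rw [Finset.sum_add_distrib, ← Finset.mul_sum] at h3
  have h4 := Finset.sum_inter_add_sum_sdiff S N a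
  rw [e1] at h1
  have := mul_le_mul_of_nonneg_left (h1.trans h2) hρ
  linarith

variable (hg : IsSubmodular g) (hg0 : ∀ S, 0 ≤ g S) (hρ : 0 ≤ ρ) (hρ1 : ρ ≤ 1)

include hg0 hρ hρ1 in
theorem abs_weight_le {u : Fin n} (hu : u ∈ useful g a ρ) : g {u} + |a u| ≤ 3 * g {u} + a u := by
  have h1 := mem_useful.1 hu
  have h2 := hg0 {u}
  have h3 : ρ * g {u} ≤ g {u} := mul_le_of_le_one_left h2 hρ1
  have h4 : 0 ≤ ρ * g ∅ := mul_nonneg hρ (hg0 ∅)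
  rcases abs_cases (a u) with h | h <;> linarith

include hg hg0 hρ hρ1 in
theorem abs_grad_le {p : ℝ} (hp0 : 0 ≤ p) (hp1 : p ≤ 1) {u : Fin n} (hu : u ∈ useful g a ρ)
    {R : Finset (Fin n)} (hR : R ⊆ useful g a ρ) : |grad g a p u R| ≤ 2 * scale g a ρ := by
  set N := useful g a ρ with hN
  set s : ℝ := g ∅ + ∑ v ∈ N, g {v} with hs
  have hs0 : 0 ≤ s := add_nonneg (hg0 _) (Finset.sum_nonneg fun v _ => hg0 _)
  have hsD : s + |a u| ≤ scale g a ρ := by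
    have h1 : ∑ v ∈ N, |a v| + ∑ v ∈ N, g {v} ≤ ∑ v ∈ N, (3 * g {v} + a v) := by
      rw [← Finset.sum_add_distrib]
      refine Finset.sum_le_sum fun v hv => ?_
      linarith [abs_weight_le hg0 hρ hρ1 hv]
    have h2 := Finset.single_le_sum (f := fun v => |a v|) (fun v _ => abs_nonneg _) hu
    rw [scale]
    linarith
  have hup : ∀ X, X ⊆ N → g X ≤ s := by
    intro X hX
    have h1 := hg.le_empty_add_sum X
    have h2 : ∑ v ∈ X, (g {v} - g ∅) ≤ ∑ v ∈ X, g {v} :=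
      Finset.sum_le_sum fun v _ => by linarith [hg0 ∅]
    have h3 := Finset.sum_le_sum_of_subset_of_nonneg hX (f := fun v => g {v}) fun v _ _ => hg0 _
    linarith
  have hm : |marg g u R| ≤ s := by
    have h1 := hup _ (Finset.insert_subset hu hR)
    have h2 := hup _ ((Finset.erase_subset u R).trans hR)
    have h3 := hg0 (insert u R)
    have h4 := hg0 (R.erase u)
    rw [marg, abs_le]
    constructor <;> linarith
  have hl : |(1 + p) * a u| ≤ 2 * |a u| := by
    rw [abs_mul, abs_of_nonneg (by linarith : 0 ≤ 1 + p)]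
    exact mul_le_mul_of_nonneg_right (by linarith) (abs_nonneg _)
  calc |grad g a p u R| ≤ |marg g u R| + |(1 + p) * a u| := abs_add_le _ _
    _ ≤ 2 * scale g a ρ := by linarith

include hg0 hρ hρ1 in
theorem scale_nonneg : 0 ≤ scale g a ρ := by
  refine add_nonneg (hg0 _) (Finset.sum_nonneg fun u hu => ?_)
  linarith [abs_weight_le hg0 hρ hρ1 hu, hg0 {u}, abs_nonneg (a u)]

include hg0 hρ in
theorem scale_le {σ H : ℝ} (hσ : ρ < σ)
    (hH : ∀ S, S ⊆ useful g a ρ → σ * g S + ∑ u ∈ S, a u ≤ H) :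
    scale g a ρ ≤ (n + 1) * ((3 / (σ - ρ) + 1) * H) := by
  have hd : 0 < σ - ρ := sub_pos.2 hσ
  have hE := hH ∅ (Finset.empty_subset _)
  rw [Finset.sum_empty, add_zero] at hE
  have hH0 : 0 ≤ H := (mul_nonneg (hρ.trans hσ.le) (hg0 _)).trans hE
  have hE' : g ∅ ≤ H / (σ - ρ) := by
    rw [le_div_iff₀ hd]
    linarith [mul_nonneg hρ (hg0 ∅)]
  have h3 : 3 / (σ - ρ) * H = 3 * (H / (σ - ρ)) := by ring
  have hHd : 0 ≤ H / (σ - ρ) := div_nonneg hH0 hd.le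
  have hu : ∀ u ∈ useful g a ρ, 3 * g {u} + a u ≤ (3 / (σ - ρ) + 1) * H := by
    intro u hu
    have h1 := hH {u} (by simpa using hu)
    rw [Finset.sum_singleton] at h1
    have h2 := mem_useful.1 hu
    have h4 : g {u} ≤ H / (σ - ρ) := by
      rw [le_div_iff₀ hd]
      linarith [mul_nonneg hρ (hg0 ∅)]
    have h5 : a u ≤ H := by linarith [mul_nonneg (hρ.trans hσ.le) (hg0 {u})]
    linarith
  have hsum := Finset.sum_le_sum hu
  rw [Finset.sum_const, nsmul_eq_mul] at hsum
  have hc : ((useful g a ρ).card : ℝ) * ((3 / (σ - ρ) + 1) * H) ≤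
      n * ((3 / (σ - ρ) + 1) * H) := by
    refine mul_le_mul_of_nonneg_right ?_ (by positivity)
    exact_mod_cast (Finset.card_le_univ _).trans (by simp)
  rw [scale]
  linarith

include hg hg0 hρ hρ1 in
theorem average_ascentValue_ge {p b : ℝ} (hp0 : 0 < p) (hp1 : p ≤ 1) (hρp : ρ < (1 - p) / (1 + p))
    (hb0 : 0 ≤ b) (hbp : b < p) {c : ℕ}
    (hc : 5 * (3 / ((1 - p) / (1 + p) - ρ) + 1) / (p - b) ≤ c) {T : ℕ}
    (hT : (c * (n + 1) * (n + 1)) * (c * (n + 1) * (n + 1)) ≤ T) (S : Finset (Fin n)) :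
    b * (ρ * g S + ∑ u ∈ S, a u) ≤
      (∑ t ∈ Finset.range T, ascentValue g a p (useful g a ρ) T
        (1 / (scale g a ρ * (c * (n + 1) * (n + 1) : ℕ))) t fun _ => 0) / T := by
  set N := useful g a ρ with hN
  set σ := (1 - p) / (1 + p) with hσ
  set D := scale g a ρ with hDdef
  set C := 3 / (σ - ρ) + 1 with hC
  have hD : 0 ≤ D := scale_nonneg hg0 hρ hρ1
  have hCpos : 0 < C := by
    have : 0 < σ - ρ := sub_pos.2 hρp
    positivity
  have hpb : 0 < p - b := sub_pos.2 hbp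
  have hc0 : (0 : ℝ) < c := lt_of_lt_of_le (by positivity) hc
  have hcN : 0 < c := by exact_mod_cast hc0
  set m : ℕ := c * (n + 1) * (n + 1) with hm
  have hm1 : 0 < m := by positivity
  have hM : (0 : ℝ) < (m : ℝ) := by exact_mod_cast hm1
  have hTm : (m : ℝ) * m ≤ T := by exact_mod_cast hT
  have hTpos : 0 < T := lt_of_lt_of_le (Nat.mul_pos hm1 hm1) hT
  have hTR : (0 : ℝ) < T := by exact_mod_cast hTpos
  have h1p : 0 < 1 + p := by linarith
  set E := (∑ t ∈ Finset.range T, ascentValue g a p N T (1 / (D * (m : ℝ))) t fun _ => 0) / T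
    with hE
  obtain ⟨S₁, hS₁, hmax⟩ := Finset.exists_max_image N.powerset
    (fun S => σ * g S + ∑ u ∈ S, a u) ⟨∅, by simp⟩
  rw [Finset.mem_powerset] at hS₁
  simp only [Finset.mem_powerset] at hmax
  set H := σ * g S₁ + ∑ u ∈ S₁, a u with hH
  have hH0 : 0 ≤ H := by
    have := hmax ∅ (Finset.empty_subset _)
    rw [Finset.sum_empty, add_zero] at this
    exact (mul_nonneg (hρ.trans hρp.le) (hg0 _)).trans this
  have hDH : D ≤ (n + 1) * (C * H) := scale_le hg0 hρ hρp hmax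
  have main := sum_ascentValue_ge hg hg0 hp0 hp1 hS₁ hD hM hTpos
    (fun u hu R hR => abs_grad_le hg hg0 hρ hρ1 hp0.le hp1 hu hR) T (x := fun _ => 0)
    (fun _ => le_rfl) (fun _ => hp0.le)
  have hpot : potential p N S₁ (D * m / 2) (fun _ => 0) ≤ D * m / 2 * n := by
    refine mul_le_mul_of_nonneg_left ?_ (by positivity)
    have : ∀ u ∈ N, (p * vertex S₁ u - 0) ^ 2 ≤ 1 := fun u _ => by
      unfold vertex; split_ifs <;> nlinarith
    refine (Finset.sum_le_sum this).trans ?_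
    rw [Finset.sum_const, nsmul_eq_mul, mul_one]
    exact_mod_cast (Finset.card_le_univ N).trans (by simp)
  have hpH : p * (1 - p) * g S₁ + (1 + p) * (p * ∑ u ∈ S₁, a u) = (1 + p) * (p * H) := by
    rw [hH, hσ]; field_simp
  rw [hpH] at main
  have hsumE : ∑ t ∈ Finset.range T, ascentValue g a p N T (1 / (D * (m : ℝ))) t (fun _ => 0) =
      T * E := by rw [hE]; field_simp
  rw [hsumE] at main
  have hDm0 : 0 ≤ D / m := div_nonneg hD hM.le
  have hm1R : (1 : ℝ) ≤ m := by exact_mod_cast hm1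
  have hTge : (m : ℝ) ≤ T := le_trans (by nlinarith) hTm
  have e1 : 2 * D / T ≤ 2 * (D / m) := by
    rw [mul_div_assoc]
    exact mul_le_mul_of_nonneg_left (div_le_div_of_nonneg_left hD hM hTge) (by norm_num)
  have e2 : D * m / 2 * n ≤ T * (n * (D / m)) := by
    have h1 : D * m = (m * m) * (D / m) := by field_simp
    have h2 : (m * m : ℝ) * (D / m) ≤ T * (D / m) := mul_le_mul_of_nonneg_right hTm hDm0
    rw [h1]
    have h3 := mul_le_mul_of_nonneg_right h2 (Nat.cast_nonneg n : (0 : ℝ) ≤ n)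
    have h4 : 0 ≤ (m * m : ℝ) * (D / m) * n := by positivity
    linarith
  have e3 : (n : ℝ) * (2 * D / m + 2 * D / T) ≤ n * (4 * (D / m)) := by
    refine mul_le_mul_of_nonneg_left ?_ (Nat.cast_nonneg n)
    have : 2 * D / m = 2 * (D / m) := by ring
    linarith
  have main2 : (1 + p) * (p * H) - 5 * (n * (D / m)) ≤ (1 + p) * E := by
    refine le_of_mul_le_mul_left ?_ hTR
    have h1 := mul_le_mul_of_nonneg_left e3 hTR.le
    linarith
  have e4 : 5 * (n * (D / m)) ≤ (p - b) * H := by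
    have h1 : (n : ℝ) * D ≤ (n + 1) * ((n + 1) * (C * H)) :=
      mul_le_mul (by linarith) hDH hD (by positivity)
    have h2 : 5 * C ≤ c * (p - b) := (div_le_iff₀ hpb).1 hc
    have h3 : (m : ℝ) = c * (n + 1) * (n + 1) := by rw [hm]; push_cast; ring
    have h4 : (n : ℝ) * (D / m) * m = n * D := by field_simp
    refine le_of_mul_le_mul_right ?_ hM
    have h5 := mul_le_mul_of_nonneg_right h2
      (by positivity : 0 ≤ ((n : ℝ) + 1) * (n + 1) * H)
    rw [mul_assoc, h4]
    calc 5 * ((n : ℝ) * D) ≤ 5 * ((n + 1) * ((n + 1) * (C * H))) := by linarith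
      _ = 5 * C * ((n + 1) * (n + 1) * H) := by ring
      _ ≤ c * (p - b) * ((n + 1) * (n + 1) * H) := h5
      _ = (p - b) * H * m := by rw [h3]; ring
  have hEbH : b * H ≤ E := by
    have h0 : 0 ≤ (p - b) * H := by positivity
    have h1 : (1 + p) * (b * H) ≤ (1 + p) * E := by
      have : (p - b) * H ≤ (1 + p) * ((p - b) * H) := le_mul_of_one_le_left h0 (by linarith)
      linarith
    exact le_of_mul_le_mul_left h1 h1p
  refine le_trans (mul_le_mul_of_nonneg_left ?_ hb0) hEbH
  have hS := le_inter_useful (a := a) hg hρ S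
  have hSN := hmax (S ∩ N) Finset.inter_subset_right
  have := mul_le_mul_of_nonneg_right hρp.le (hg0 (S ∩ N))
  linarith

end Guarantee

/-! ### Expectations of program runs -/

section Calculus

variable {n : ℕ}

/-- Iteration of a transformer of functions on states. -/
def iterWp (w : (State n → ℝ) → State n → ℝ) : ℕ → (State n → ℝ) → State n → ℝ
  | 0, F => F
  | k + 1, F => w (iterWp w k F)

open Classical in
/-- The expectation of `F` at the final state, as a function of the initial state. -/
def wp (I : Inst n) : Program → (State n → ℝ) → State n → ℝ
  | .skip, F => F
  | .instr i, F => fun σ => F (i.run I σ)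
  | .flip x, F => fun σ => (F (σ.setNat x 0) + F (σ.setNat x 1)) / 2
  | .seq c d, F => wp I c (wp I d F)
  | .ite t c d, F => fun σ => if t.Holds σ then wp I c F σ else wp I d F σ
  | .loop x c, F => fun σ => iterWp (wp I c) (σ.nat x) F σ

theorem iterWp_nonneg {w : (State n → ℝ) → State n → ℝ}
    (hw : ∀ F, (∀ σ, 0 ≤ F σ) → ∀ σ, 0 ≤ w F σ) (k : ℕ) (F : State n → ℝ) (hF : ∀ σ, 0 ≤ F σ) :
    ∀ σ, 0 ≤ iterWp w k F σ := by
  induction k with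
  | zero => exact hF
  | succ k ih => exact hw _ ih

theorem wp_nonneg (I : Inst n) (c : Program) (F : State n → ℝ) (hF : ∀ σ, 0 ≤ F σ) :
    ∀ σ, 0 ≤ wp I c F σ := by
  induction c generalizing F with
  | skip => exact hF
  | instr i => exact fun σ => hF _
  | flip x =>
      intro σ
      have := hF (σ.setNat x 0)
      have := hF (σ.setNat x 1)
      simp only [wp]; linarith
  | seq c d hc hd => exact hc _ (hd _ hF)
  | ite t c d hc hd =>
    intro σ
    simp only [wp]
    split_ifs
    · exact hc _ hF σ
    · exact hd _ hF σ
  | loop x c hc => exact fun σ => iterWp_nonneg hc _ F hF σ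

theorem wp_linear (I : Inst n) (c : Program) (F G : State n → ℝ) (s : ℝ) :
    wp I c (fun σ => F σ + s * G σ) = fun σ => wp I c F σ + s * wp I c G σ := by
  induction c generalizing F G with
  | skip => rfl
  | instr i => rfl
  | flip x => funext σ; simp only [wp]; ring
  | seq c d hc hd => simp only [wp, hd, hc]
  | ite t c d hc hd =>
    funext σ
    simp only [wp, hc, hd]
    split_ifs <;> rfl
  | loop x c hc =>
    funext σ
    simp only [wp]
    generalize σ.nat x = k
    have : iterWp (wp I c) k (fun σ => F σ + s * G σ) =
        fun σ => iterWp (wp I c) k F σ + s * iterWp (wp I c) k G σ := by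
      induction k with
      | zero => rfl
      | succ k ih => simp only [iterWp, ih, hc]
    rw [this]

theorem wp_zero (I : Inst n) (c : Program) : wp I c (fun _ => 0) = fun _ => 0 := by
  have := wp_linear I c (fun _ => 0) (fun _ => 0) (-1)
  funext σ
  have h := congrFun this σ
  simp only [mul_zero, add_zero] at h
  linarith

theorem wp_sum (I : Inst n) (c : Program) {ι : Type*} (s : Finset ι) (w : ι → ℝ)
    (F : ι → State n → ℝ) (σ : State n) :
    wp I c (fun σ => ∑ i ∈ s, w i * F i σ) σ = ∑ i ∈ s, w i * wp I c (F i) σ := by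
  classical
  induction s using Finset.induction_on with
  | empty => simp [wp_zero]
  | insert i s hi ih =>
    simp only [Finset.sum_insert hi]
    rw [← ih]
    have := congrFun (wp_linear I c (fun σ => ∑ j ∈ s, w j * F j σ) (F i) (w i)) σ
    simp only [add_comm (w i * _)]
    exact this

open scoped ENNReal

/-- The expectation of a nonnegative function. -/
def lmean {α : Type*} (μ : PMF α) (φ : α → ℝ≥0∞) : ℝ≥0∞ := ∑' r, μ r * φ r

theorem lmean_pure {α : Type*} (a : α) (φ : α → ℝ≥0∞) : lmean (PMF.pure a) φ = φ a := by
  rw [lmean, tsum_eq_single a]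
  · simp
  · intro b hb; simp [PMF.pure_apply, hb]

theorem lmean_bind {α β : Type*} (μ : PMF α) (ν : α → PMF β) (φ : β → ℝ≥0∞) :
    lmean (μ.bind ν) φ = lmean μ fun a => lmean (ν a) φ := by
  simp only [lmean, PMF.bind_apply, ← ENNReal.tsum_mul_right, ← ENNReal.tsum_mul_left]
  rw [ENNReal.tsum_comm]
  simp only [mul_assoc]

theorem lmean_map {α β : Type*} (μ : PMF α) (h : α → β) (φ : β → ℝ≥0∞) :
    lmean (μ.map h) φ = lmean μ fun a => φ (h a) := by
  rw [← PMF.bind_pure_comp, lmean_bind]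
  simp only [Function.comp_apply, lmean_pure]

theorem lmean_exec (I : Inst n) (c : Program) (F : State n → ℝ) (hF : ∀ σ, 0 ≤ F σ)
    (σ : State n) :
    lmean (c.exec I σ) (fun r => ENNReal.ofReal (F r.1)) = ENNReal.ofReal (wp I c F σ) := by
  induction c generalizing F σ with
  | skip => simp [Program.exec, lmean_pure, wp]
  | instr i => simp [Program.exec, lmean_pure, wp]
  | flip x =>
    simp only [Program.exec, lmean_map, wp]
    rw [lmean, tsum_bool]
    simp only [PMF.uniformOfFintype_apply, Fintype.card_bool, Bool.toNat_false, Bool.toNat_true]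
    rw [ENNReal.ofReal_div_of_pos two_pos, ENNReal.ofReal_add (hF _) (hF _), ← mul_add,
      ENNReal.div_eq_inv_mul]
    simp
  | seq c d hc hd =>
    simp only [Program.exec, lmean_bind, lmean_map, wp, hd F hF]
    exact hc _ (wp_nonneg I d F hF) σ
  | ite t c d hc hd =>
    simp only [Program.exec, lmean_map, wp]
    split_ifs
    · exact hc F hF σ
    · exact hd F hF σ
  | loop x c hc =>
    simp only [Program.exec, wp]
    generalize σ.nat x = k
    induction k generalizing σ with
    | zero => simp [iterate, lmean_pure, iterWp]
    | succ k ih =>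
      simp only [iterate, lmean_bind, lmean_map, iterWp, ih]
      exact hc _ (iterWp_nonneg (wp_nonneg I c) k F hF) σ

theorem expectedValue_eq_wp (P : Program) (I : Inst n) :
    P.expectedValue I = wp I P (fun σ => I.g (σ.set 0) + I.l (σ.set 0)) (State.init n) := by
  classical
  have h : ∀ T, (P.output I T).toReal =
      wp I P (fun σ => if σ.set 0 = T then 1 else 0) (State.init n) := by
    intro T
    have h0 : ∀ σ : State n, (0 : ℝ) ≤ if σ.set 0 = T then 1 else 0 := fun σ => by
      split_ifs <;> norm_num
    rw [← ENNReal.toReal_ofReal (wp_nonneg I P _ h0 _), ← lmean_exec I P _ h0]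
    congr 1
    rw [Program.output, PMF.map_apply, lmean]
    refine tsum_congr fun r => ?_
    by_cases hr : r.1.set 0 = T
    · simp [hr]
    · simp [hr, Ne.symm hr]
  have e : (fun σ : State n => I.g (σ.set 0) + I.l (σ.set 0)) = fun σ =>
      ∑ T : Finset (Fin n), (I.g T + I.l T) * if σ.set 0 = T then 1 else 0 := by
    funext σ; simp
  rw [Program.expectedValue, e, wp_sum]
  simp only [h, mul_comm]

/-! ### Specifications of programs -/

/-- `Spec I c σ t E post`: a run of `c` from `σ` takes at most `t` steps; it ends in a state that
satisfies `post a` for some abstract result `a`; and the expectation of a function of the final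
state is at least the abstract expectation `E` of any lower bound in terms of the result. -/
structure Spec (I : Inst n) {α : Type} (c : Program) (σ : State n) (t : ℕ)
    (E : (α → ℝ) → ℝ) (post : α → State n → Prop) : Prop where
  time : ∀ r ∈ (c.exec I σ).support, r.2 ≤ t ∧ ∃ a, post a r.1
  mean : ∀ (F : State n → ℝ) (f : α → ℝ), (∀ a σ', post a σ' → f a ≤ F σ') → E f ≤ wp I c F σ

namespace Spec

variable {I : Inst n} {α β : Type} {c d : Program} {σ : State n} {t t' : ℕ}
  {E : (α → ℝ) → ℝ} {post : α → State n → Prop}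

theorem conseq {E' : (β → ℝ) → ℝ} {post' : β → State n → Prop} (h : Spec I c σ t E post)
    (e : α → β) (ht : t ≤ t') (hE : ∀ f, E' f ≤ E fun a => f (e a))
    (hpost : ∀ a σ', post a σ' → post' (e a) σ') : Spec I c σ t' E' post' where
  time r hr := by
    obtain ⟨h1, a, h2⟩ := h.time r hr
    exact ⟨h1.trans ht, e a, hpost a _ h2⟩
  mean F f hf := (hE f).trans (h.mean F _ fun a σ' ha => hf _ σ' (hpost a σ' ha))

theorem mono {E' : (α → ℝ) → ℝ} (h : Spec I c σ t E post) (ht : t ≤ t')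
    (hE : ∀ f, E' f ≤ E f) : Spec I c σ t' E' post :=
  h.conseq (fun a => a) ht hE fun _ _ h => h

theorem skip {a : α} (h : post a σ) : Spec I .skip σ 0 (fun f => f a) post where
  time r hr := by
    simp only [Program.exec, PMF.support_pure, Set.mem_singleton_iff] at hr
    subst hr
    exact ⟨le_rfl, a, h⟩
  mean F f hf := hf _ _ h

theorem instr {a : α} (i : Instr) (h : post a (i.run I σ)) :
    Spec I (.instr i) σ 1 (fun f => f a) post where
  time r hr := by
    simp only [Program.exec, PMF.support_pure, Set.mem_singleton_iff] at hr
    subst hr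
    exact ⟨le_rfl, a, h⟩
  mean F f hf := hf _ _ h

theorem flip {x : ℕ} {a b : α} (h0 : post a (σ.setNat x 0)) (h1 : post b (σ.setNat x 1)) :
    Spec I (.flip x) σ 1 (fun f => (f a + f b) / 2) post where
  time r hr := by
    simp only [Program.exec, PMF.support_map, Set.mem_image] at hr
    obtain ⟨v, -, rfl⟩ := hr
    cases v
    · exact ⟨le_rfl, a, h0⟩
    · exact ⟨le_rfl, b, h1⟩
  mean F f hf := by
    have := hf _ _ h0
    have := hf _ _ h1
    simp only [wp]; linarith

theorem seq {E' : α → (β → ℝ) → ℝ} {post' : β → State n → Prop} (h : Spec I c σ t E post)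
    (h' : ∀ a σ', post a σ' → Spec I d σ' t' (E' a) post') :
    Spec I (.seq c d) σ (t + t') (fun f => E fun a => E' a f) post' where
  time r hr := by
    simp only [Program.exec, PMF.mem_support_bind_iff, PMF.support_map, Set.mem_image] at hr
    obtain ⟨r1, hr1, r2, hr2, rfl⟩ := hr
    obtain ⟨h1, a, ha⟩ := h.time r1 hr1
    obtain ⟨h2, b, hb⟩ := (h' a _ ha).time r2 hr2
    exact ⟨Nat.add_le_add h1 h2, b, hb⟩
  mean F f hf := h.mean _ _ fun a σ' ha => (h' a σ' ha).mean F f hf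

theorem ite_pos {s : Test} (hs : s.Holds σ) (h : Spec I c σ t E post) :
    Spec I (.ite s c d) σ (t + 1) E post where
  time r hr := by
    simp only [Program.exec, if_pos hs, PMF.support_map, Set.mem_image] at hr
    obtain ⟨r1, hr1, rfl⟩ := hr
    obtain ⟨h1, a, ha⟩ := h.time r1 hr1
    exact ⟨Nat.add_le_add_right h1 1, a, ha⟩
  mean F f hf := by
    simp only [wp, if_pos hs]
    exact h.mean F f hf

theorem ite_neg {s : Test} (hs : ¬ s.Holds σ) (h : Spec I d σ t E post) :
    Spec I (.ite s c d) σ (t + 1) E post where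
  time r hr := by
    simp only [Program.exec, if_neg hs, PMF.support_map, Set.mem_image] at hr
    obtain ⟨r1, hr1, rfl⟩ := hr
    obtain ⟨h1, a, ha⟩ := h.time r1 hr1
    exact ⟨Nat.add_le_add_right h1 1, a, ha⟩
  mean F f hf := by
    simp only [wp, if_neg hs]
    exact h.mean F f hf

theorem ite {s : Test} (h : s.Holds σ → Spec I c σ t E post)
    (h' : ¬ s.Holds σ → Spec I d σ t E post) : Spec I (.ite s c d) σ (t + 1) E post := by
  by_cases hs : s.Holds σ
  · exact ite_pos hs (h hs)
  · exact ite_neg hs (h' hs)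

end Spec

/-- The composition of the abstract expectations `B i, …, B (i + m - 1)`. -/
def chain {α : Type} (B : ℕ → α → (α → ℝ) → ℝ) : ℕ → ℕ → α → (α → ℝ) → ℝ
  | _, 0, a, f => f a
  | i, m + 1, a, f => B i a fun a' => chain B (i + 1) m a' f

theorem Spec.loop {I : Inst n} {α : Type} {body : Program} {t N : ℕ} {B : ℕ → α → (α → ℝ) → ℝ}
    {J : ℕ → α → State n → Prop}
    (hbody : ∀ k a σ, k < N → J k a σ → Spec I body σ t (B k a) (J (k + 1)))
    {x : ℕ} {a : α} {σ : State n} (h0 : J 0 a σ) (hN : σ.nat x = N) :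
    Spec I (.loop x body) σ (N * (t + 1) + 1) (chain B 0 N a) (J N) := by
  have key : ∀ m k a σ, k + m = N → J k a σ →
      (∀ r ∈ (iterate (body.exec I) m σ).support, r.2 ≤ m * (t + 1) + 1 ∧ ∃ a, J N a r.1) ∧
      ∀ (F : State n → ℝ) (f : α → ℝ), (∀ a σ', J N a σ' → f a ≤ F σ') →
        chain B k m a f ≤ iterWp (wp I body) m F σ := by
    intro m
    induction m with
    | zero =>
      intro k a σ hk hJ
      have : k = N := by omega
      subst this
      refine ⟨fun r hr => ?_, fun F f hf => hf _ _ hJ⟩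
      simp only [iterate, PMF.support_pure, Set.mem_singleton_iff] at hr
      subst hr
      exact ⟨by simp, a, hJ⟩
    | succ m ih =>
      intro k a σ hk hJ
      have hb := hbody k a σ (by omega) hJ
      refine ⟨fun r hr => ?_, fun F f hf => ?_⟩
      · simp only [iterate, PMF.mem_support_bind_iff, PMF.support_map, Set.mem_image] at hr
        obtain ⟨r1, hr1, r2, hr2, rfl⟩ := hr
        obtain ⟨h1, a', ha'⟩ := hb.time r1 hr1
        obtain ⟨h2, b, hb'⟩ := (ih (k + 1) a' r1.1 (by omega) ha').1 r2 hr2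
        refine ⟨?_, b, hb'⟩
        have e : (m + 1) * (t + 1) + 1 = t + (m * (t + 1) + 1) + 1 := by ring
        simp only [e]
        omega
      · exact hb.mean _ _ fun a' σ' ha' => (ih (k + 1) a' σ' (by omega) ha').2 F f hf
  have := key N 0 a σ (by simp) h0
  constructor
  · simpa only [Program.exec, hN] using this.1
  · simpa only [wp, hN] using this.2

/-- A straight-line program. -/
def block : List Instr → Program
  | [] => .skip
  | i :: s => .seq (.instr i) (block s)

/-- The effect of a straight-line program. -/
def runAll (I : Inst n) : List Instr → State n → State n
  | [], σ => σ
  | i :: s, σ => runAll I s (i.run I σ)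

theorem Spec.block {I : Inst n} {α : Type} {post : α → State n → Prop} {a : α} (l : List Instr)
    {σ : State n} (h : post a (runAll I l σ)) :
    Spec I (block l) σ l.length (fun f => f a) post := by
  induction l generalizing σ with
  | nil => exact Spec.skip h
  | cons i s ih =>
    have h1 : Spec I (.instr i) σ 1 (fun f : Unit → ℝ => f ()) fun _ σ' => σ' = i.run I σ :=
      Spec.instr i rfl
    refine (h1.seq (E' := fun _ f => f a) (t' := s.length) (post' := post) ?_).mono
      (by simp [add_comm]) (fun _ => le_rfl)
    rintro _ _ rfl
    exact ih h

theorem chain_unit (f : Unit → ℝ) (m i : ℕ) :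
    chain (fun _ (_ : Unit) (f : Unit → ℝ) => f ()) i m () f = f () := by
  induction m generalizing i with
  | zero => rfl
  | succ m ih => exact ih _

/-- A loop with a deterministic abstract effect. -/
theorem Spec.loop_unit {I : Inst n} {body : Program} {t N : ℕ} {J : ℕ → State n → Prop}
    (hbody : ∀ k σ, k < N → J k σ →
      Spec I body σ t (fun f : Unit → ℝ => f ()) fun _ => J (k + 1))
    {x : ℕ} {σ : State n} (h0 : J 0 σ) (hN : σ.nat x = N) :
    Spec I (.loop x body) σ (N * (t + 1) + 1) (fun f : Unit → ℝ => f ()) fun _ => J N := by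
  have h := Spec.loop (I := I) (B := fun _ _ f => f ()) (J := fun k (_ : Unit) => J k)
    (fun k _ σ hk hJ => hbody k σ hk hJ) (a := ()) h0 hN
  refine h.mono le_rfl (fun f => le_of_eq ?_)
  exact (chain_unit f N 0).symm

end Calculus

/-! ### The program -/

/-- Draw a uniformly random number below `2 ^ K` into register `7`, where `K` is in register `6`. -/
def draw : Program :=
  .seq (block [.natConst 7 0])
    (.loop 6 (.seq (.flip 8) (block [.natAdd 7 7 7, .natAdd 7 7 8])))

/-- Run `c` for all elements of the ground set, whose number is in register `1`. -/
def forEach (c : Program) : Program :=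
  .seq (block [.natConst 1 0]) (.loop 0 (.seq c (block [.natAdd 1 1 2])))

/-- Decide at random whether the current element belongs to the sampled set. -/
def sampleElement : Program :=
  .seq draw (.seq
    (block [.natAdd 9 7 2, .realOfNat 9 9, .realDiv 9 9 8, .natAdd 10 1 11, .realLoad 10 10])
    (.ite (.mem 1 1)
      (.ite (.realLE 9 10) (.instr (.setInsert 0 1)) (.instr (.setErase 0 1)))
      (.seq .skip (.instr (.setErase 0 1)))))

/-- Update the coordinate of the current element. -/
def updateElement : Program :=
  .seq (.ite (.mem 1 0)
      (block [.queryG 2 0, .setErase 0 1, .queryG 3 0, .setInsert 0 1])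
      (block [.queryG 3 0, .setInsert 0 1, .queryG 2 0, .setErase 0 1])) (.seq
    (block [.setInsert 2 1, .queryL 4 2, .setErase 2 1, .realMul 4 11 4, .realSub 2 2 3,
      .realAdd 2 2 4, .realMul 2 5 2, .natAdd 10 1 11, .realLoad 10 10, .realAdd 10 10 2]) (.seq
    (.ite (.realLE 10 0) (block [.realAdd 10 0 0]) .skip) (.seq
    (.ite (.realLE 7 10) (block [.realAdd 10 7 0]) .skip)
    (block [.realStore 10 10]))))

/-- Decide whether the current element is useful, and update the scale. -/
def filterElement : Program :=
  .seq (block [.setInsert 2 1, .queryG 2 2, .queryL 4 2, .setErase 2 1, .realSub 3 2 1,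
      .realMul 3 6 3, .realAdd 3 3 4])
    (.ite (.realLE 3 0) .skip
      (block [.setInsert 1 1, .realAdd 5 5 2, .realAdd 5 5 2, .realAdd 5 5 2, .realAdd 5 5 4]))

/-- Compute `M = c (n + 1)²`, and the first power `2 ^ K` of two that exceeds `M²`. -/
def gridSize : Program :=
  .seq (.loop 13 (.loop 13 (block [.natAdd 3 3 12]))) (.seq
    (.loop 3 (block [.natAdd 4 4 3]))
    (.loop 4 (.ite (.natLE 5 4) (block [.natAdd 5 5 5, .natAdd 6 6 2]) .skip)))

/-- Set the constants. -/
def constants (c : ℕ) (ρ p : ℚ) : List Instr :=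
  [.natConst 2 1, .natConst 11 16, .natConst 12 c, .natAdd 13 0 2, .natConst 5 1,
    .realConst 6 ρ, .realConst 7 p, .realConst 11 (1 + p), .queryG 1 0, .queryG 5 0]

/-- Online gradient ascent, stopped at a random time. -/
def ascent (c : ℕ) (ρ p : ℚ) : Program :=
  .seq (block (constants c ρ p)) (.seq gridSize (.seq (block [.realOfNat 8 5]) (.seq
    (forEach filterElement) (.seq
    (block [.realOfNat 9 3, .realMul 5 5 9, .realConst 9 1, .realDiv 5 9 5]) (.seq
    draw (.seq
    (.loop 7 (.seq (forEach sampleElement) (forEach updateElement)))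
    (forEach sampleElement)))))))

/-! ### Its specification -/

section

variable {n : ℕ} {I : Inst n}

theorem chain_bits (m v : ℕ) (i : ℕ) (f : ℕ → ℝ) :
    chain (fun _ v (f : ℕ → ℝ) => (f (2 * v) + f (2 * v + 1)) / 2) i m v f =
      (∑ j ∈ Finset.range (2 ^ m), f (2 ^ m * v + j)) / 2 ^ m := by
  induction m generalizing v i with
  | zero => simp [chain]
  | succ m ih =>
    simp only [chain, ih]
    rw [pow_succ 2 m, mul_two, Finset.sum_range_add]
    have e1 : ∀ j, (2 ^ m + 2 ^ m) * v + j = 2 ^ m * (2 * v) + j := fun j => by ring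
    have e2 : ∀ j, (2 ^ m + 2 ^ m) * v + (2 ^ m + j) = 2 ^ m * (2 * v + 1) + j := fun j => by ring
    rw [Finset.sum_congr rfl fun j _ => congrArg f (e1 j),
      Finset.sum_congr rfl fun j _ => congrArg f (e2 j), pow_succ]
    field_simp

theorem spec_draw {K : ℕ} {σ : State n} (hK : σ.nat 6 = K) :
    Spec I draw σ (4 * K + 2) (fun f : ℕ → ℝ => (∑ v ∈ Finset.range (2 ^ K), f v) / 2 ^ K)
      fun v σ' => v < 2 ^ K ∧ σ'.real = σ.real ∧ σ'.set = σ.set ∧ σ'.nat 7 = v ∧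
        ∀ j, j ≠ 7 → j ≠ 8 → σ'.nat j = σ.nat j := by
  have h0 : Spec I (block [.natConst 7 0]) σ 1 (fun f : Unit → ℝ => f ())
      fun _ σ' => σ' = σ.setNat 7 0 := Spec.block _ rfl
  refine (h0.seq (E' := fun _ => chain (fun _ v (f : ℕ → ℝ) => (f (2 * v) + f (2 * v + 1)) / 2)
    0 K 0) (t' := K * (1 + 2 + 1) + 1) (post' := fun v σ' => v < 2 ^ K ∧ σ'.real = σ.real ∧
      σ'.set = σ.set ∧ σ'.nat 7 = v ∧ ∀ j, j ≠ 7 → j ≠ 8 → σ'.nat j = σ.nat j) ?_).mono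
    (by omega) (fun f => by simp [chain_bits])
  rintro _ _ rfl
  refine Spec.loop (J := fun k v σ' => v < 2 ^ k ∧ σ'.real = σ.real ∧
      σ'.set = σ.set ∧ σ'.nat 7 = v ∧ ∀ j, j ≠ 7 → j ≠ 8 → σ'.nat j = σ.nat j) ?_ ?_ ?_
  · rintro k v σ' - ⟨hv, hr, hs, h7, hj⟩
    have hf : Spec I (.flip 8) σ' 1 (fun f : ℕ → ℝ => (f 0 + f 1) / 2)
      fun b σ'' => b < 2 ∧ σ'' = σ'.setNat 8 b := Spec.flip ⟨by norm_num, rfl⟩ ⟨by norm_num, rfl⟩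
    refine (hf.seq (E' := fun b f => f (2 * v + b)) (t' := 2) ?_).mono le_rfl
      (fun f => le_rfl)
    rintro b _ ⟨hb, rfl⟩
    refine Spec.block _ ⟨by rw [pow_succ]; omega, ?_, ?_, ?_, ?_⟩
    · simp [runAll, Instr.run, State.setNat, hr]
    · simp [runAll, Instr.run, State.setNat, hs]
    · simp [runAll, Instr.run, State.setNat, h7, two_mul]
    · intro j h7 h8
      simp [runAll, Instr.run, State.setNat, h7, h8, hj]
  · refine ⟨by norm_num, rfl, rfl, by simp [State.setNat], fun j h7 _ => by
      simp [State.setNat, h7]⟩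
  · simp [State.setNat, hK]

theorem spec_forEach {α : Type} {c : Program} {t : ℕ} {B : ℕ → α → (α → ℝ) → ℝ}
    {J : ℕ → α → State n → Prop}
    (hJ : ∀ k a σ v, J k a σ → J k a (σ.setNat 1 v))
    (hJ' : ∀ k a σ, J k a σ → σ.nat 0 = n ∧ σ.nat 2 = 1)
    (hc : ∀ k a σ, k < n → J k a σ → σ.nat 1 = k →
      Spec I c σ t (B k a) fun a σ' => J (k + 1) a σ' ∧ σ'.nat 1 = k)
    {a : α} {σ : State n} (h0 : J 0 a σ) :
    Spec I (forEach c) σ (n * (t + 2) + 2) (chain B 0 n a) (J n) := by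
  have hb : Spec I (block [.natConst 1 0]) σ 1 (fun f : Unit → ℝ => f ())
      fun _ σ' => σ' = σ.setNat 1 0 := Spec.block _ rfl
  refine (hb.seq (E' := fun _ => chain B 0 n a) (t' := n * (t + 1 + 1) + 1) ?_).mono
    (by ring_nf; rfl) (fun f => le_rfl)
  rintro _ _ rfl
  refine (Spec.loop (J := fun k a σ => J k a σ ∧ σ.nat 1 = k) ?_ ⟨hJ _ _ _ _ h0, ?_⟩ ?_).conseq
    id le_rfl (fun f => le_rfl) fun _ _ h => h.1
  · rintro k a σ hk ⟨h1, h2⟩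
    refine (hc k a σ hk h1 h2).seq (E' := fun a f => f a) (t' := 1) ?_
    rintro a' σ' ⟨h3, h4⟩
    refine Spec.block _ ⟨?_, ?_⟩
    · exact hJ _ _ _ _ h3
    · simp [runAll, Instr.run, State.setNat, h4, (hJ' _ _ _ h3).2]
  · simp [State.setNat]
  · simpa [State.setNat] using (hJ' _ _ _ h0).1

/-- The contents of the registers that never change after the constants are set, and a vector
stored in the real registers from `16` on. -/
structure Base (I : Inst n) (ρ p : ℝ) (x : Fin n → ℝ) (σ : State n) : Prop where
  size : σ.nat 0 = n
  one : σ.nat 2 = 1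
  base : σ.nat 11 = 16
  zero : σ.real 0 = 0
  gEmpty : σ.real 1 = I.g ∅
  rho : σ.real 6 = ρ
  box : σ.real 7 = p
  slope : σ.real 11 = 1 + p
  temp : σ.set 2 = ∅
  vec : ∀ u : Fin n, σ.real (u + 16) = x u

/-- The memory during the ascent. -/
structure Ready (I : Inst n) (ρ p : ℝ) (K : ℕ) (r : ℝ) (N : Finset (Fin n)) (x : Fin n → ℝ)
    (σ : State n) : Prop extends Base I ρ p x σ where
  bits : σ.nat 6 = K
  rate : σ.real 5 = r
  grid : σ.real 8 = 2 ^ K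
  useful : σ.set 1 = N

variable {ρ p r : ℝ} {K : ℕ} {N : Finset (Fin n)} {x : Fin n → ℝ} {σ σ' : State n}

theorem Base.congr (h : Base I ρ p x σ) (h0 : σ'.nat 0 = σ.nat 0) (h2 : σ'.nat 2 = σ.nat 2)
    (h11 : σ'.nat 11 = σ.nat 11) (r0 : σ'.real 0 = σ.real 0) (r1 : σ'.real 1 = σ.real 1)
    (r6 : σ'.real 6 = σ.real 6) (r7 : σ'.real 7 = σ.real 7) (r11 : σ'.real 11 = σ.real 11)
    (s2 : σ'.set 2 = σ.set 2) {y : Fin n → ℝ} (hy : ∀ u : Fin n, σ'.real (u + 16) = y u) :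
    Base I ρ p y σ' :=
  ⟨h0.trans h.size, h2.trans h.one, h11.trans h.base, r0.trans h.zero, r1.trans h.gEmpty,
    r6.trans h.rho, r7.trans h.box, r11.trans h.slope, s2.trans h.temp, hy⟩

theorem Ready.congr (h : Ready I ρ p K r N x σ)
    (hn : ∀ j ∈ [0, 2, 6, 11], σ'.nat j = σ.nat j)
    (hr : ∀ j ∈ [0, 1, 5, 6, 7, 8, 11], σ'.real j = σ.real j)
    (s1 : σ'.set 1 = σ.set 1) (s2 : σ'.set 2 = σ.set 2)
    {y : Fin n → ℝ} (hy : ∀ u : Fin n, σ'.real (u + 16) = y u) :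
    Ready I ρ p K r N y σ' where
  toBase := h.toBase.congr (hn _ (by simp)) (hn _ (by simp)) (hn _ (by simp)) (hr _ (by simp))
    (hr _ (by simp)) (hr _ (by simp)) (hr _ (by simp)) (hr _ (by simp)) s2 hy
  bits := (hn _ (by simp)).trans h.bits
  rate := (hr _ (by simp)).trans h.rate
  grid := (hr _ (by simp)).trans h.grid
  useful := s1.trans h.useful

theorem average_threshold {T : ℕ} (hT : 0 < T) {y : ℝ} (hy0 : 0 ≤ y) (hy1 : y ≤ 1) (A B : ℝ) :
    (∑ v ∈ Finset.range T, if ((v : ℝ) + 1) / T ≤ y then A else B) / T =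
      (⌊y * T⌋₊ : ℝ) / T * A + (1 - (⌊y * T⌋₊ : ℝ) / T) * B := by
  have hT' : (0 : ℝ) < T := by exact_mod_cast hT
  have hle : ⌊y * T⌋₊ ≤ T := by
    have h : y * T ≤ T := mul_le_of_le_one_left hT'.le hy1
    exact (Nat.floor_le_floor h).trans (by simp)
  have hiff : ∀ v : ℕ, ((v : ℝ) + 1) / T ≤ y ↔ v < ⌊y * T⌋₊ := by
    intro v
    rw [div_le_iff₀ hT', ← Nat.succ_le_iff, Nat.le_floor_iff (by positivity)]
    push_cast
    rfl
  have e1 : (Finset.range T).filter (fun v => v < ⌊y * T⌋₊) = Finset.range ⌊y * T⌋₊ := by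
    ext v; simp; omega
  have e2 : ((Finset.range T).filter fun v => ¬ v < ⌊y * T⌋₊).card = T - ⌊y * T⌋₊ := by
    have := Finset.card_filter_add_card_filter_not (s := Finset.range T) (fun v => v < ⌊y * T⌋₊)
    rw [e1] at this
    simp only [Finset.card_range] at this
    omega
  simp only [hiff]
  rw [Finset.sum_ite, Finset.sum_const, Finset.sum_const, e1, e2]
  simp only [Finset.card_range, nsmul_eq_mul, Nat.cast_sub hle]
  field_simp

theorem spec_sampleElement {R : Finset (Fin n)} {k : ℕ} (hk : k < n) (h : Ready I ρ p K r N x σ)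
    (hx0 : ∀ u, 0 ≤ x u) (hx1 : ∀ u, x u ≤ 1) (h1 : σ.nat 1 = k) (hR : σ.set 0 = R) :
    Spec I sampleElement σ (4 * K + 10)
      (fun f : Finset (Fin n) → ℝ =>
        roundDown N (2 ^ K) x ⟨k, hk⟩ * f (insert ⟨k, hk⟩ R)
          + (1 - roundDown N (2 ^ K) x ⟨k, hk⟩) * f (R.erase ⟨k, hk⟩))
      fun R' σ' => (Ready I ρ p K r N x σ' ∧ σ'.set 0 = R') ∧ σ'.nat 1 = k := by
  refine ((spec_draw (I := I) h.bits).seq (t' := 8) (E' := fun (v : ℕ) f =>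
    if ⟨k, hk⟩ ∈ N then if ((v : ℝ) + 1) / 2 ^ K ≤ x ⟨k, hk⟩ then f (insert ⟨k, hk⟩ R)
      else f (R.erase ⟨k, hk⟩) else f (R.erase ⟨k, hk⟩)) ?_).mono (by omega) (fun f => ?_)
  · rintro v σ₁ ⟨-, hr1, hs1, h7, hj⟩
    have hb : Spec I (block [.natAdd 9 7 2, .realOfNat 9 9, .realDiv 9 9 8, .natAdd 10 1 11,
        .realLoad 10 10]) σ₁ 5 (fun f : Unit → ℝ => f ())
        fun _ σ' => Ready I ρ p K r N x σ' ∧ σ'.set 0 = R ∧ σ'.nat 1 = k ∧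
          σ'.real 9 = ((v : ℝ) + 1) / 2 ^ K ∧ σ'.real 10 = x ⟨k, hk⟩ := by
      refine Spec.block _ ⟨h.congr ?_ ?_ ?_ ?_ ?_, ?_, ?_, ?_, ?_⟩
      · simp [runAll, Instr.run, State.setNat, State.setReal, hj]
      · simp [runAll, Instr.run, State.setNat, State.setReal, hr1]
      · simp [runAll, Instr.run, State.setNat, State.setReal, hs1]
      · simp [runAll, Instr.run, State.setNat, State.setReal, hs1]
      · simp [runAll, Instr.run, State.setNat, State.setReal, hr1, h.vec]
      · simp [runAll, Instr.run, State.setNat, State.setReal, hs1, hR]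
      · simp [runAll, Instr.run, State.setNat, State.setReal, hj, h1]
      · simp [runAll, Instr.run, State.setNat, State.setReal, hj, hr1, h7, h.grid, h.one]
      · simp [runAll, Instr.run, State.setNat, State.setReal, hj, hr1, h1, h.base,
          ← h.vec ⟨k, hk⟩]
    refine (hb.seq (t' := 3) (E' := fun _ f => if ⟨k, hk⟩ ∈ N then
      if ((v : ℝ) + 1) / 2 ^ K ≤ x ⟨k, hk⟩ then f (insert ⟨k, hk⟩ R)
      else f (R.erase ⟨k, hk⟩) else f (R.erase ⟨k, hk⟩)) ?_).mono le_rfl (fun _ => le_rfl)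
    rintro _ σ₂ ⟨hR2, h0, hk2, h9, h10⟩
    have hmem : Test.Holds σ₂ (.mem 1 1) ↔ ⟨k, hk⟩ ∈ N := by
      simp [Test.Holds, hR2.useful, hk2, hk]
    have hins : Spec I (.instr (.setInsert 0 1)) σ₂ 1
        (fun f : Finset (Fin n) → ℝ => f (insert ⟨k, hk⟩ R))
        fun R' σ' => (Ready I ρ p K r N x σ' ∧ σ'.set 0 = R') ∧ σ'.nat 1 = k := by
      have e : Instr.run I σ₂ (.setInsert 0 1) = σ₂.setSet 0 (insert ⟨k, hk⟩ R) := by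
        simp [Instr.run, hk2, hk, h0]
      refine Spec.instr _ ?_
      rw [e]
      exact ⟨⟨hR2.congr (σ' := σ₂.setSet 0 _) (fun _ _ => rfl) (fun _ _ => rfl) rfl rfl hR2.vec, rfl⟩,
        hk2⟩
    have hera : Spec I (.instr (.setErase 0 1)) σ₂ 1
        (fun f : Finset (Fin n) → ℝ => f (R.erase ⟨k, hk⟩))
        fun R' σ' => (Ready I ρ p K r N x σ' ∧ σ'.set 0 = R') ∧ σ'.nat 1 = k := by
      have e : Instr.run I σ₂ (.setErase 0 1) = σ₂.setSet 0 (R.erase ⟨k, hk⟩) := by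
        simp [Instr.run, hk2, hk, h0]
      refine Spec.instr _ ?_
      rw [e]
      exact ⟨⟨hR2.congr (σ' := σ₂.setSet 0 _) (fun _ _ => rfl) (fun _ _ => rfl) rfl rfl hR2.vec, rfl⟩,
        hk2⟩
    refine Spec.ite (t := 2) (fun hm => ?_) fun hm => ?_
    · simp only [hmem.1 hm, if_true]
      refine Spec.ite (t := 1) (fun hle => ?_) fun hle => ?_
      · have : ((v : ℝ) + 1) / 2 ^ K ≤ x ⟨k, hk⟩ := by rwa [← h9, ← h10]
        simpa only [this, if_true] using hins
      · have : ¬ ((v : ℝ) + 1) / 2 ^ K ≤ x ⟨k, hk⟩ := by rwa [← h9, ← h10]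
        simpa only [this, if_false] using hera
    · have : ⟨k, hk⟩ ∉ N := fun h => hm (hmem.2 h)
      simp only [this, if_false]
      have hs : Spec I .skip σ₂ 0 (fun f : Unit → ℝ => f ()) fun _ σ' => σ' = σ₂ := Spec.skip rfl
      refine (hs.seq (E' := fun _ f => f (R.erase ⟨k, hk⟩)) (t' := 1) ?_).mono (by omega)
        (fun _ => le_rfl)
      rintro _ _ rfl
      exact hera
  · by_cases hN : (⟨k, hk⟩ : Fin n) ∈ N
    · have := average_threshold (T := 2 ^ K) (by positivity) (hx0 ⟨k, hk⟩) (hx1 ⟨k, hk⟩)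
        (f (insert ⟨k, hk⟩ R)) (f (R.erase ⟨k, hk⟩))
      push_cast at this
      simp only [roundDown, hN, if_true]
      push_cast
      rw [this]
    · simp [roundDown, hN]

theorem chain_resample (z : Fin n → ℝ) (f : Finset (Fin n) → ℝ) (m k : ℕ) (hk : k + m = n)
    (R : Finset (Fin n)) :
    chain (fun k R (f : Finset (Fin n) → ℝ) => if h : k < n then
      z ⟨k, h⟩ * f (insert ⟨k, h⟩ R) + (1 - z ⟨k, h⟩) * f (R.erase ⟨k, h⟩) else 0) k m R f =
      resample z ((List.finRange n).drop k) f R := by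
  induction m generalizing k R with
  | zero =>
    have : (List.finRange n).drop k = [] := List.drop_eq_nil_of_le (by simp; omega)
    simp [this, chain, resample]
  | succ m ih =>
    have hkn : k < n := by omega
    rw [List.drop_eq_getElem_cons (by simpa using hkn)]
    simp only [chain, hkn, dif_pos, resample, ih (k + 1) (by omega), List.getElem_finRange]
    rfl

theorem spec_sample (h : Ready I ρ p K r N x σ) (hx0 : ∀ u, 0 ≤ x u) (hx1 : ∀ u, x u ≤ 1) :
    Spec I (forEach sampleElement) σ (n * (4 * K + 12) + 2)
      (fun f : Finset (Fin n) → ℝ => ext (roundDown N (2 ^ K) x) f)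
      fun R σ' => Ready I ρ p K r N x σ' ∧ σ'.set 0 = R := by
  refine (spec_forEach (t := 4 * K + 10)
    (B := fun k R (f : Finset (Fin n) → ℝ) => if h : k < n then
      roundDown N (2 ^ K) x ⟨k, h⟩ * f (insert ⟨k, h⟩ R)
        + (1 - roundDown N (2 ^ K) x ⟨k, h⟩) * f (R.erase ⟨k, h⟩) else 0)
    (J := fun _ R σ' => Ready I ρ p K r N x σ' ∧ σ'.set 0 = R) ?_ ?_ ?_ (a := σ.set 0)
      ⟨h, rfl⟩).mono le_rfl (fun f => le_of_eq ?_)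
  · rintro - R σ v ⟨h1, h2⟩
    exact ⟨h1.congr (σ' := σ.setNat 1 v) (by simp [State.setNat]) (fun _ _ => rfl) rfl rfl h1.vec, h2⟩
  · exact fun _ R σ h => ⟨h.1.size, h.1.one⟩
  · intro k R σ hk h hk1
    simp only [hk, dif_pos]
    exact spec_sampleElement hk h.1 hx0 hx1 hk1 h.2
  · rw [chain_resample _ _ _ _ (by simp), List.drop_zero, resample_finRange]

end

section

variable {n : ℕ} {I : Inst n} {a : Fin n → ℝ}
variable {ρ p r : ℝ} {K : ℕ} {N : Finset (Fin n)} {x : Fin n → ℝ} {σ σ' : State n}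

/-- The state `σ'` agrees with `σ` outside the scratch registers of the coordinate update, and
`v` is the next value of coordinate `k`. -/
structure Pending (σ : State n) (k : ℕ) (v : ℝ) (σ' : State n) : Prop where
  value : σ'.real 10 = v
  real : ∀ j, j ≠ 2 → j ≠ 3 → j ≠ 4 → j ≠ 10 → σ'.real j = σ.real j
  set : σ'.set = σ.set
  addr : σ'.nat 10 = k + 16
  nat : ∀ j, j ≠ 10 → σ'.nat j = σ.nat j

theorem spec_marginal {k : ℕ} (hk : k < n) (h1 : σ.nat 1 = k) :
    Spec I (.ite (.mem 1 0)
      (block [.queryG 2 0, .setErase 0 1, .queryG 3 0, .setInsert 0 1])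
      (block [.queryG 3 0, .setInsert 0 1, .queryG 2 0, .setErase 0 1])) σ 5
      (fun f : Unit → ℝ => f ()) fun _ σ' =>
        σ'.real 2 = I.g (insert ⟨k, hk⟩ (σ.set 0)) ∧ σ'.real 3 = I.g ((σ.set 0).erase ⟨k, hk⟩) ∧
        (∀ j, j ≠ 2 → j ≠ 3 → σ'.real j = σ.real j) ∧ σ'.set = σ.set ∧ σ'.nat = σ.nat := by
  have hmem : Test.Holds σ (.mem 1 0) ↔ (⟨k, hk⟩ : Fin n) ∈ σ.set 0 := by
    simp [Test.Holds, h1, hk]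
  refine Spec.ite (t := 4) (fun hm => ?_) fun hm => ?_
  · rw [hmem] at hm
    refine Spec.block _ ⟨?_, ?_, fun j h2 h3 => ?_, ?_, ?_⟩
    · simp [runAll, Instr.run, State.setReal, State.setSet, h1, hk, Finset.insert_eq_of_mem hm]
    · simp [runAll, Instr.run, State.setReal, State.setSet, h1, hk]
    · simp [runAll, Instr.run, State.setReal, State.setSet, h1, hk, h2, h3]
    · simp [runAll, Instr.run, State.setReal, State.setSet, h1, hk, Finset.insert_erase hm]
    · simp [runAll, Instr.run, State.setReal, State.setSet, h1, hk]
  · rw [hmem] at hm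
    refine Spec.block _ ⟨?_, ?_, fun j h2 h3 => ?_, ?_, ?_⟩
    · simp [runAll, Instr.run, State.setReal, State.setSet, h1, hk]
    · simp [runAll, Instr.run, State.setReal, State.setSet, h1, hk,
        Finset.erase_eq_of_notMem hm]
    · simp [runAll, Instr.run, State.setReal, State.setSet, h1, hk, h2, h3]
    · simp [runAll, Instr.run, State.setReal, State.setSet, h1, hk, Finset.erase_insert hm]
    · simp [runAll, Instr.run, State.setReal, State.setSet, h1, hk]

theorem spec_updateElement (ha : ∀ S, I.l S = ∑ u ∈ S, a u) {R : Finset (Fin n)} {k : ℕ}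
    (hk : k < n) (h : Ready I ρ p K r N x σ) (h1 : σ.nat 1 = k) (hR : σ.set 0 = R) :
    Spec I updateElement σ 22 (fun f : Unit → ℝ => f ()) fun _ σ' =>
      (Ready I ρ p K r N (Function.update x ⟨k, hk⟩
        (min p (max 0 (x ⟨k, hk⟩ + r * grad I.g a p ⟨k, hk⟩ R)))) σ' ∧ σ'.set 0 = R)
        ∧ σ'.nat 1 = k := by
  set y := x ⟨k, hk⟩ + r * grad I.g a p ⟨k, hk⟩ R with hy
  refine (spec_marginal hk h1).seq (E' := fun _ f => f ()) (t' := 17) ?_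
  rintro _ σ₁ ⟨hg1, hg2, hr1, hs1, hn1⟩
  have h2e : σ₁.set 2 = ∅ := by rw [hs1, h.temp]
  refine Spec.seq (E := fun f : Unit → ℝ => f ()) (E' := fun _ f => f ()) (t := 10) (t' := 7)
    (post := fun _ => Pending σ k y) (Spec.block _ ?_) ?_
  · refine ⟨?_, fun j h2 h3 h4 h10 => ?_, ?_, ?_, fun j h10 => ?_⟩
    · have hx := h.vec ⟨k, hk⟩
      simp only at hx
      simp [runAll, Instr.run, State.setReal, State.setSet, State.setNat, hn1, h1, hk, hs1, h.base,
        hr1, h.rate, h.slope, hg1, hg2, hR, ha, h.temp, hx, hy, grad, marg]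
    · simp [runAll, Instr.run, State.setReal, State.setSet, State.setNat, hn1, h1, hk, hr1, h2, h3,
        h4, h10]
    · simp [runAll, Instr.run, State.setReal, State.setSet, State.setNat, hn1, h1, hk, hs1, h.temp]
    · simp [runAll, Instr.run, State.setReal, State.setSet, State.setNat, hn1, h1, hk, h.base]
    · simp [runAll, Instr.run, State.setReal, State.setSet, State.setNat, hn1, h1, hk, h10]
  intro _ σ₂ P2
  refine Spec.seq (E := fun f : Unit → ℝ => f ()) (E' := fun _ f => f ()) (t := 2) (t' := 5)
    (post := fun _ => Pending σ k (max 0 y)) ?_ ?_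
  · have h0 : σ₂.real 0 = 0 := by rw [P2.real 0 (by simp) (by simp) (by simp) (by simp), h.zero]
    refine Spec.ite (t := 1) (fun hm => ?_) fun hm => ?_
    · simp only [Test.Holds, P2.value, h0] at hm
      refine Spec.block _ ⟨?_, fun j h2 h3 h4 h10 => ?_, P2.set, P2.addr, P2.nat⟩
      · simp [runAll, Instr.run, State.setReal, h0, hm]
      · simp [runAll, Instr.run, State.setReal, h10, P2.real j h2 h3 h4 h10]
    · simp only [Test.Holds, P2.value, h0, not_le] at hm
      refine (Spec.skip ?_).mono (Nat.zero_le 1) fun _ => le_rfl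
      rwa [max_eq_right hm.le]
  intro _ σ₃ P3
  refine Spec.seq (E := fun f : Unit → ℝ => f ()) (E' := fun _ f => f ()) (t := 2) (t' := 3)
    (post := fun _ => Pending σ k (min p (max 0 y))) ?_ ?_
  · have h0 : σ₃.real 0 = 0 := by rw [P3.real 0 (by simp) (by simp) (by simp) (by simp), h.zero]
    have h7 : σ₃.real 7 = p := by rw [P3.real 7 (by simp) (by simp) (by simp) (by simp), h.box]
    refine Spec.ite (t := 1) (fun hm => ?_) fun hm => ?_
    · simp only [Test.Holds, P3.value, h7] at hm
      refine Spec.block _ ⟨?_, fun j h2 h3 h4 h10 => ?_, P3.set, P3.addr, P3.nat⟩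
      · rw [min_eq_left hm]
        simp [runAll, Instr.run, State.setReal, h0, h7]
      · simp [runAll, Instr.run, State.setReal, h10, P3.real j h2 h3 h4 h10]
    · simp only [Test.Holds, P3.value, h7, not_le] at hm
      refine (Spec.skip ?_).mono (Nat.zero_le 1) fun _ => le_rfl
      rwa [min_eq_right hm.le]
  intro _ σ₄ P4
  refine (Spec.block (a := ()) _ ⟨⟨h.congr ?_ ?_ ?_ ?_ fun u => ?_, ?_⟩, ?_⟩).mono
    (by simp) fun _ => le_rfl
  · simp [runAll, Instr.run, State.setReal, P4.nat]
  · simp [runAll, Instr.run, State.setReal, P4.addr, P4.real, Function.update_apply]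
  · simp [runAll, Instr.run, State.setReal, P4.set]
  · simp [runAll, Instr.run, State.setReal, P4.set]
  · by_cases hu : u = ⟨k, hk⟩
    · subst hu
      simp [runAll, Instr.run, State.setReal, P4.addr, P4.value]
    · have hne : (u : ℕ) ≠ k := fun h => hu (Fin.ext h)
      simp [runAll, Instr.run, State.setReal, P4.addr, P4.real, hu, hne,
        h.vec]
  · simp [runAll, Instr.run, State.setReal, P4.set, hR]
  · simp [runAll, Instr.run, State.setReal, P4.nat, h1]

theorem spec_forEach_unit {c : Program} {t : ℕ} {J : ℕ → State n → Prop}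
    (hJ : ∀ k σ v, J k σ → J k (σ.setNat 1 v)) (hJ' : ∀ k σ, J k σ → σ.nat 0 = n ∧ σ.nat 2 = 1)
    (hc : ∀ k σ, k < n → J k σ → σ.nat 1 = k →
      Spec I c σ t (fun f : Unit → ℝ => f ()) fun _ σ' => J (k + 1) σ' ∧ σ'.nat 1 = k)
    (h0 : J 0 σ) :
    Spec I (forEach c) σ (n * (t + 2) + 2) (fun f : Unit → ℝ => f ()) fun _ => J n := by
  refine (spec_forEach (B := fun _ _ f => f ()) (J := fun k (_ : Unit) => J k)
    (fun k _ => hJ k) (fun k _ => hJ' k) (fun k _ => hc k) (a := ()) h0).mono le_rfl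
    fun f => le_of_eq ?_
  exact (chain_unit f n 0).symm

theorem spec_update (ha : ∀ S, I.l S = ∑ u ∈ S, a u) {R : Finset (Fin n)}
    (h : Ready I ρ p K r N x σ) (hR : σ.set 0 = R) :
    Spec I (forEach updateElement) σ (n * 24 + 2) (fun f : Unit → ℝ => f ()) fun _ σ' =>
      Ready I ρ p K r N (ascend I.g a p r x R) σ' := by
  refine (spec_forEach_unit (t := 22) (J := fun k σ' => Ready I ρ p K r N
    (fun u => if (u : ℕ) < k then ascend I.g a p r x R u else x u) σ' ∧ σ'.set 0 = R)
    ?_ ?_ ?_ ?_).conseq (fun u => u) le_rfl (fun _ => le_rfl) fun _ σ' h => ?_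
  · rintro k σ v ⟨h1, h2⟩
    exact ⟨h1.congr (σ' := σ.setNat 1 v) (by simp [State.setNat]) (fun _ _ => rfl) rfl rfl h1.vec,
      h2⟩
  · exact fun k σ h => ⟨h.1.size, h.1.one⟩
  · rintro k σ hk ⟨h1, h2⟩ hk1
    have e : (fun u : Fin n => if (u : ℕ) < k + 1 then ascend I.g a p r x R u else x u) =
        Function.update (fun u : Fin n => if (u : ℕ) < k then ascend I.g a p r x R u else x u)
          ⟨k, hk⟩ (min p (max 0 (x ⟨k, hk⟩ + r * grad I.g a p ⟨k, hk⟩ R))) := by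
      funext u
      by_cases hu : u = ⟨k, hk⟩
      · subst hu; simp [ascend]
      · have hne : (u : ℕ) ≠ k := fun h => hu (Fin.ext h)
        have : (u : ℕ) < k + 1 ↔ (u : ℕ) < k := by omega
        simp [hu, this]
    rw [e]
    simpa using spec_updateElement ha hk h1 hk1 h2
  · simpa using ⟨h, hR⟩
  · simpa using h.1

theorem spec_ascent_loop (ha : ∀ S, I.l S = ∑ u ∈ S, a u) (hp0 : 0 ≤ p) (hp1 : p ≤ 1)
    (h : Ready I ρ p K r N x σ) (hx0 : ∀ u, 0 ≤ x u) (hxp : ∀ u, x u ≤ p) {τ : ℕ}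
    (hτ : σ.nat 7 = τ) :
    Spec I (.seq (.loop 7 (.seq (forEach sampleElement) (forEach updateElement)))
        (forEach sampleElement)) σ
      (τ * (n * (4 * K + 12) + 2 + (n * 24 + 2) + 1) + 1 + (n * (4 * K + 12) + 2))
      (fun f : Finset (Fin n) → ℝ => chain (fun _ x (f : (Fin n → ℝ) → ℝ) =>
        ext (roundDown N (2 ^ K) x) fun R => f (ascend I.g a p r x R)) 0 τ x
          fun x => ext (roundDown N (2 ^ K) x) f)
      fun R σ' => σ'.set 0 = R := by
  refine (Spec.loop (t := n * (4 * K + 12) + 2 + (n * 24 + 2)) (J := fun _ x σ' =>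
    Ready I ρ p K r N x σ' ∧ (∀ u, 0 ≤ x u) ∧ ∀ u, x u ≤ p) ?_ ⟨h, hx0, hxp⟩ hτ).seq ?_
  · rintro k x σ - ⟨h, hx0, hxp⟩
    refine (spec_sample h hx0 fun u => (hxp u).trans hp1).seq
      (E' := fun R f => f (ascend I.g a p r x R)) ?_
    rintro R σ' ⟨h', hR⟩
    exact (spec_update ha h' hR).conseq (fun _ => ascend I.g a p r x R) le_rfl (fun _ => le_rfl)
      fun _ σ'' h'' => ⟨h'', fun u => (ascend_mem hp0 r x R u).1,
        fun u => (ascend_mem hp0 r x R u).2⟩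
  · rintro x σ' ⟨h, hx0, hxp⟩
    exact (spec_sample h hx0 fun u => (hxp u).trans hp1).conseq (fun R => R) le_rfl
      (fun _ => le_rfl) fun _ _ h => h.2

theorem chain_ascentValue (g : Finset (Fin n) → ℝ) (τ i : ℕ) (x : Fin n → ℝ) (T : ℕ) :
    chain (fun _ x (f : (Fin n → ℝ) → ℝ) =>
        ext (roundDown N T x) fun R => f (ascend g a p r x R)) i τ x
          (fun x => ext (roundDown N T x) (objective g a)) = ascentValue g a p N T r τ x := by
  induction τ generalizing i x with
  | zero => rfl
  | succ τ ih => simp only [chain, ascentValue, ih]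

end

section

variable {n : ℕ} {I : Inst n} {a : Fin n → ℝ} {ρ p : ℝ} {K : ℕ} {σ : State n}

theorem spec_gridSize {c : ℕ} (hc : 0 < c) (h2 : σ.nat 2 = 1) (h13 : σ.nat 13 = n + 1)
    (h12 : σ.nat 12 = c) (h3 : σ.nat 3 = 0) (h4 : σ.nat 4 = 0) (h5 : σ.nat 5 = 1)
    (h6 : σ.nat 6 = 0) {M : ℕ} (hM : M = c * (n + 1) * (n + 1)) :
    Spec I gridSize σ
      (((n + 1) * ((n + 1) * 2 + 1 + 1) + 1) + ((M * 2 + 1) + (M * M * 4 + 1)))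
      (fun f : Unit → ℝ => f ()) fun _ σ' =>
        (σ'.nat 6 = Nat.log 2 (M * M) + 1 ∧ σ'.nat 5 = 2 ^ (Nat.log 2 (M * M) + 1)) ∧
        σ'.nat 3 = M ∧ σ'.real = σ.real ∧ σ'.set = σ.set ∧
        ∀ j, j ∉ [3, 4, 5, 6] → σ'.nat j = σ.nat j := by
  have hMpos : 0 < M := by rw [hM]; positivity
  refine Spec.seq (E := fun f : Unit → ℝ => f ()) (E' := fun _ f => f ())
    (post := fun _ σ' => σ'.nat 3 = M ∧ σ'.real = σ.real ∧ σ'.set = σ.set ∧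
      ∀ j, j ≠ 3 → σ'.nat j = σ.nat j) ?_ ?_
  · refine (Spec.loop_unit (N := n + 1) (t := (n + 1) * 2 + 1) (J := fun k σ' =>
      σ'.nat 3 = k * ((n + 1) * c) ∧ σ'.real = σ.real ∧ σ'.set = σ.set ∧
      ∀ j, j ≠ 3 → σ'.nat j = σ.nat j) ?_ (by simp [h3]) h13).conseq (fun u => u) le_rfl
      (fun _ => le_rfl) fun _ σ' h => ?_
    · rintro k σ₁ - ⟨e3, er, es, ej⟩
      refine (Spec.loop_unit (N := n + 1) (t := 1) (J := fun l σ' =>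
        σ'.nat 3 = k * ((n + 1) * c) + l * c ∧ σ'.real = σ.real ∧ σ'.set = σ.set ∧
        ∀ j, j ≠ 3 → σ'.nat j = σ.nat j) ?_ (by simp [e3, er, es]; exact ej)
        (by rw [ej 13 (by simp), h13])).conseq (fun u => u) le_rfl (fun _ => le_rfl)
        fun _ σ' h => ⟨by rw [h.1]; ring, h.2⟩
      rintro l σ₂ - ⟨e3', er', es', ej'⟩
      refine Spec.block _ ⟨?_, er', es', fun j hj => ?_⟩
      · simp [runAll, Instr.run, State.setNat, e3', ej', h12]; ring
      · simp [runAll, Instr.run, State.setNat, hj, ej']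
    · exact ⟨by rw [h.1, hM]; ring, h.2⟩
  rintro _ σ₁ ⟨e3, er, es, ej⟩
  refine Spec.seq (E := fun f : Unit → ℝ => f ()) (E' := fun _ f => f ())
    (post := fun _ σ' => σ'.nat 4 = M * M ∧ σ'.nat 3 = M ∧ σ'.real = σ.real ∧ σ'.set = σ.set ∧
      ∀ j, j ∉ [3, 4] → σ'.nat j = σ.nat j) ?_ ?_
  · refine Spec.loop_unit (N := M) (t := 1) (J := fun k σ' =>
      σ'.nat 4 = k * M ∧ σ'.nat 3 = M ∧ σ'.real = σ.real ∧ σ'.set = σ.set ∧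
      ∀ j, j ∉ [3, 4] → σ'.nat j = σ.nat j) ?_ ?_ e3
    · rintro k σ₂ - ⟨e4, e3, er, es, ej⟩
      refine Spec.block _ ⟨?_, ?_, er, es, fun j hj => ?_⟩
      · simp [runAll, Instr.run, State.setNat, e4, e3]; ring
      · simp [runAll, Instr.run, State.setNat, e3]
      · have : j ≠ 4 := fun h => hj (by simp [h])
        simp [runAll, Instr.run, State.setNat, ej j hj, this]
    · exact ⟨by rw [ej 4 (by simp), h4, zero_mul], e3, er, es, fun j hj =>
        ej j fun h => hj (by simp [h])⟩
  rintro _ σ₂ ⟨e4, e3, er, es, ej⟩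
  refine (Spec.loop_unit (N := M * M) (t := 3) (J := fun k σ' =>
      (∃ K, K ≤ k ∧ (M * M < 2 ^ K ∨ K = k) ∧ 2 ^ K ≤ 2 * (M * M) ∧ σ'.nat 6 = K ∧
        σ'.nat 5 = 2 ^ K) ∧ σ'.nat 4 = M * M ∧ σ'.nat 3 = M ∧ σ'.real = σ.real ∧
        σ'.set = σ.set ∧ ∀ j, j ∉ [3, 4, 5, 6] → σ'.nat j = σ.nat j) ?_ ?_ e4).conseq
      (fun u => u) le_rfl (fun _ => le_rfl) fun _ σ' h => ?_
  · rintro k σ₃ - ⟨⟨K, hK, hK', hK2, h6, h5⟩, e4, e3, er, es, ej⟩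
    refine Spec.ite (t := 2) (fun hm => ?_) fun hm => ?_
    · simp only [Test.Holds, h5, e4] at hm
      have hKk : K = k := hK'.resolve_left (by omega)
      refine Spec.block _ ⟨⟨K + 1, by omega, Or.inr (by omega), by rw [pow_succ]; omega, ?_, ?_⟩,
        ?_, ?_, er, es, fun j hj => ?_⟩
      · simp [runAll, Instr.run, State.setNat, h6, ej 2, h2]
      · simp [runAll, Instr.run, State.setNat, h5, pow_succ, mul_two]
      · simp [runAll, Instr.run, State.setNat, e4]
      · simp [runAll, Instr.run, State.setNat, e3]
      · have j5 : j ≠ 5 := fun h => hj (by simp [h])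
        have j6 : j ≠ 6 := fun h => hj (by simp [h])
        simp [runAll, Instr.run, State.setNat, ej j hj, j5, j6]
    · simp only [Test.Holds, h5, e4, not_le] at hm
      exact (Spec.skip ⟨⟨K, by omega, Or.inl hm, hK2, h6, h5⟩, e4, e3, er, es, ej⟩).mono
        (Nat.zero_le 2) fun _ => le_rfl
  · have : 0 < M * M := Nat.mul_pos hMpos hMpos
    exact ⟨⟨0, le_rfl, Or.inr rfl, by simp; omega, by rw [ej 6 (by simp), h6],
      by rw [ej 5 (by simp), h5, pow_zero]⟩, e4, e3, er, es,
      fun j hj => ej j fun h => hj (by simp at h ⊢; omega)⟩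
  · obtain ⟨⟨K, hK, hK', hK2, h6, h5⟩, e4, e3, er, es, ej⟩ := h
    have hlt : M * M < 2 ^ K := hK'.elim id fun h => h ▸ Nat.lt_two_pow_self
    have hK0 : K ≠ 0 := by
      rintro rfl
      have := Nat.mul_pos hMpos hMpos
      rw [pow_zero] at hlt
      omega
    obtain ⟨L, rfl⟩ := Nat.exists_eq_succ_of_ne_zero hK0
    have hL : Nat.log 2 (M * M) = L :=
      Nat.log_eq_of_pow_le_of_lt_pow (by rw [Nat.succ_eq_add_one, pow_succ] at hK2; omega) hlt
    rw [hL]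
    exact ⟨⟨h6, h5⟩, e3, er, es, ej⟩

theorem spec_filter (ha : ∀ S, I.l S = ∑ u ∈ S, a u) (h : Base I ρ p (fun _ => 0) σ)
    {m K : ℕ} (h3 : σ.nat 3 = m) (h6 : σ.nat 6 = K) (h8 : σ.real 8 = 2 ^ K)
    (h5 : σ.real 5 = I.g ∅) (h1 : σ.set 1 = ∅) :
    Spec I (forEach filterElement) σ (n * 15 + 2) (fun f : Unit → ℝ => f ()) fun _ σ' =>
      Base I ρ p (fun _ => 0) σ' ∧ σ'.nat 3 = m ∧ σ'.nat 6 = K ∧ σ'.real 8 = 2 ^ K ∧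
        σ'.set 1 = useful I.g a ρ ∧ σ'.real 5 = scale I.g a ρ := by
  set U : ℕ → Finset (Fin n) := fun k => (useful I.g a ρ).filter fun u => (u : ℕ) < k with hU
  have hU0 : U 0 = ∅ := by simp [hU]
  have hUn : U n = useful I.g a ρ := by ext u; simp [hU]
  have hUin : ∀ k (hk : k < n), (⟨k, hk⟩ : Fin n) ∈ useful I.g a ρ →
      U (k + 1) = insert ⟨k, hk⟩ (U k) := by
    intro k hk hu
    ext u
    by_cases huk : u = ⟨k, hk⟩
    · subst huk; simp [hU, hu]
    · have hne : (u : ℕ) ≠ k := fun h => huk (Fin.ext h)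
      have : (u : ℕ) ≤ k ↔ (u : ℕ) < k := by omega
      simp [hU, huk, this]
  have hUout : ∀ k (hk : k < n), (⟨k, hk⟩ : Fin n) ∉ useful I.g a ρ → U (k + 1) = U k := by
    intro k hk hu
    ext u
    by_cases huk : u = ⟨k, hk⟩
    · subst huk; simp [hU, hu]
    · have hne : (u : ℕ) ≠ k := fun h => huk (Fin.ext h)
      have : (u : ℕ) ≤ k ↔ (u : ℕ) < k := by omega
      simp [hU, this]
  have hUk : ∀ k (hk : k < n), (⟨k, hk⟩ : Fin n) ∉ U k := by intro k hk; simp [hU]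
  refine (spec_forEach_unit (t := 13) (J := fun k σ' => Base I ρ p (fun _ => 0) σ' ∧
    σ'.nat 3 = m ∧ σ'.nat 6 = K ∧ σ'.real 8 = 2 ^ K ∧ σ'.set 1 = U k ∧
      σ'.real 5 = I.g ∅ + ∑ u ∈ U k, (3 * I.g {u} + a u)) ?_ ?_ ?_ ?_).conseq (fun u => u) le_rfl
      (fun _ => le_rfl) fun _ σ' h => ?_
  · rintro k σ v ⟨hb, h3, h6, h8, h1, h5⟩
    exact ⟨hb.congr (σ' := σ.setNat 1 v) rfl rfl rfl rfl rfl rfl rfl rfl rfl hb.vec, h3, h6, h8,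
      h1, h5⟩
  · exact fun k σ h => ⟨h.1.size, h.1.one⟩
  · rintro k σ hk ⟨hb, h3, h6, h8, h1, h5⟩ hk1
    set u : Fin n := ⟨k, hk⟩ with hu
    refine Spec.seq (E := fun f : Unit → ℝ => f ()) (E' := fun _ f => f ()) (t := 7) (t' := 6)
      (post := fun _ σ' => Base I ρ p (fun _ => 0) σ' ∧ σ'.nat 3 = m ∧ σ'.nat 6 = K ∧
        σ'.real 8 = 2 ^ K ∧ σ'.set 1 = U k ∧
        σ'.real 5 = I.g ∅ + ∑ u ∈ U k, (3 * I.g {u} + a u) ∧ σ'.nat 1 = k ∧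
        σ'.real 2 = I.g {u} ∧ σ'.real 4 = a u ∧
        σ'.real 3 = ρ * (I.g {u} - I.g ∅) + a u) (Spec.block _ ?_) ?_
    · refine ⟨hb.congr ?_ ?_ ?_ ?_ ?_ ?_ ?_ ?_ ?_ fun v => ?_, ?_, ?_, ?_, ?_, ?_, ?_, ?_, ?_, ?_⟩
      all_goals simp [runAll, Instr.run, State.setReal, State.setSet, hk1, hk,
        hb.temp, h3, h6, h8, h1, h5, ha, hb.rho, hb.gEmpty, hb.vec, ← hu]
    rintro _ σ₁ ⟨hb, h3, h6, h8, h1, h5, hk1, g2, l4, t3⟩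
    refine Spec.ite (t := 5) (fun hm => ?_) fun hm => ?_
    · simp only [Test.Holds, t3, hb.zero] at hm
      have hnot : u ∉ useful I.g a ρ := fun h => not_lt.2 hm (mem_useful.1 h)
      refine (Spec.skip ?_).mono (Nat.zero_le 5) fun _ => le_rfl
      rw [hUout k hk hnot]
      exact ⟨⟨hb, h3, h6, h8, h1, h5⟩, hk1⟩
    · simp only [Test.Holds, t3, hb.zero, not_le] at hm
      have hin : u ∈ useful I.g a ρ := mem_useful.2 hm
      rw [hUin k hk hin, Finset.sum_insert (hUk k hk)]
      refine Spec.block _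
        ⟨⟨hb.congr ?_ ?_ ?_ ?_ ?_ ?_ ?_ ?_ ?_ fun v => ?_, ?_, ?_, ?_, ?_, ?_⟩, ?_⟩
      all_goals simp [runAll, Instr.run, State.setReal, State.setSet, hk1, hk,
        h3, h6, h8, h1, h5, hb.vec, g2, l4, ← hu]
      ring
  · exact ⟨h, h3, h6, h8, by rw [hU0, h1], by simp [hU0, h5]⟩
  · rw [hUn] at h
    exact h

/-- A bound for the running time of the ascent, in terms of the size of the ground set. -/
def timeBound (n M : ℕ) : ℕ :=
  10 + ((((n + 1) * ((n + 1) * 2 + 1 + 1) + 1) + ((M * 2 + 1) + (M * M * 4 + 1))) + (1 +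
    ((n * 15 + 2) + (4 + ((4 * (M * M) + 2) +
      (2 * (M * M) * (n * (4 * (M * M) + 12) + 2 + (n * 24 + 2) + 1) + 1
        + (n * (4 * (M * M) + 12) + 2)))))))

/-- The expectation of `f` at the output of the ascent. -/
def ascentMean (g : Finset (Fin n) → ℝ) (a : Fin n → ℝ) (ρ p : ℝ) (M T : ℕ)
    (f : Finset (Fin n) → ℝ) : ℝ :=
  (∑ τ ∈ Finset.range T,
    chain (fun _ x (f : (Fin n → ℝ) → ℝ) => ext (roundDown (useful g a ρ) T x) fun R =>
      f (ascend g a p (1 / (scale g a ρ * M)) x R)) 0 τ (fun _ => 0)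
      fun x => ext (roundDown (useful g a ρ) T x) f) / T

theorem spec_ascent (ha : ∀ S, I.l S = ∑ u ∈ S, a u) {c : ℕ} (hc : 0 < c) {ρ p : ℚ}
    (hp0 : (0 : ℝ) ≤ p) (hp1 : (p : ℝ) ≤ 1) {M T : ℕ} (hM : M = c * (n + 1) * (n + 1))
    (hT : T = 2 ^ (Nat.log 2 (M * M) + 1)) :
    Spec I (ascent c ρ p) (State.init n) (timeBound n M)
      (ascentMean I.g a ρ p M T)
      fun R σ' => σ'.set 0 = R := by
  have hM0 : M * M ≠ 0 := by
    have : 0 < M := by rw [hM]; positivity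
    positivity
  set K := Nat.log 2 (M * M) + 1 with hK
  have hKM : K ≤ M * M := Nat.log_lt_of_lt_pow hM0 Nat.lt_two_pow_self
  have hTM : 2 ^ K ≤ 2 * (M * M) := by
    have := Nat.pow_log_le_self 2 hM0
    rw [hK, pow_succ]
    omega
  have hTK : (T : ℝ) = 2 ^ K := by rw [hT]; push_cast; rfl
  refine (Spec.block (I := I) (a := ()) (post := fun _ σ => Base I ρ p (fun _ => 0) σ ∧
    σ.nat 13 = n + 1 ∧ σ.nat 12 = c ∧ σ.nat 3 = 0 ∧ σ.nat 4 = 0 ∧ σ.nat 5 = 1 ∧ σ.nat 6 = 0 ∧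
    σ.real 5 = I.g ∅ ∧ σ.set 1 = ∅) (constants c ρ p) ?_).seq
    (E' := fun _ => ascentMean I.g a ρ p M T) ?_
  · refine ⟨⟨?_, ?_, ?_, ?_, ?_, ?_, ?_, ?_, ?_, fun u => ?_⟩, ?_, ?_, ?_, ?_, ?_, ?_, ?_, ?_⟩
    all_goals simp [constants, runAll, Instr.run, State.setNat, State.setReal, State.init]
  rintro _ σ₁ ⟨hb, h13, h12, h3, h4, h5, h6, r5, s1⟩
  refine (spec_gridSize hc hb.one h13 h12 h3 h4 h5 h6 hM).seq
    (E' := fun _ => ascentMean I.g a ρ p M T) ?_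
  rintro _ σ₂ ⟨⟨h6, h5⟩, h3, er, es, ej⟩
  have hb : Base I ρ p (fun _ => 0) σ₂ := hb.congr (ej _ (by simp)) (ej _ (by simp))
    (ej _ (by simp)) (by rw [er]) (by rw [er]) (by rw [er]) (by rw [er]) (by rw [er]) (by rw [es])
    (by rw [er]; exact hb.vec)
  rw [← hK] at h5 h6
  rw [← er] at r5
  rw [← es] at s1
  refine (Spec.block (I := I) (a := ()) (post := fun _ σ => Base I ρ p (fun _ => 0) σ ∧
    σ.nat 3 = M ∧ σ.nat 6 = K ∧ σ.real 8 = 2 ^ K ∧ σ.real 5 = I.g ∅ ∧ σ.set 1 = ∅)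
    [.realOfNat 8 5] ?_).seq
    (E' := fun _ => ascentMean I.g a ρ p M T) ?_
  · refine ⟨hb.congr ?_ ?_ ?_ ?_ ?_ ?_ ?_ ?_ ?_ fun u => ?_, h3, h6, ?_, ?_, s1⟩
    all_goals simp [runAll, Instr.run, State.setReal, h5, r5, hb.vec]
  rintro _ σ₃ ⟨hb, h3, h6, r8, r5, s1⟩
  refine (spec_filter ha hb h3 h6 r8 r5 s1).seq
    (E' := fun _ => ascentMean I.g a ρ p M T) ?_
  rintro _ σ₄ ⟨hb, h3, h6, r8, s1, r5⟩
  refine (Spec.block (I := I) (a := ()) (post := fun _ => Ready I ρ p K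
    (1 / (scale I.g a ρ * M)) (useful I.g a ρ) fun _ => 0)
    [.realOfNat 9 3, .realMul 5 5 9, .realConst 9 1, .realDiv 5 9 5] ?_).seq
    (E' := fun _ => ascentMean I.g a ρ p M T) ?_
  · refine ⟨hb.congr ?_ ?_ ?_ ?_ ?_ ?_ ?_ ?_ ?_ fun u => ?_, h6, ?_, ?_, s1⟩
    all_goals simp [runAll, Instr.run, State.setReal, h3, r5, r8, hb.vec]
  rintro _ σ₅ hR
  have htime : 4 * K + 2 + (2 ^ K * (n * (4 * K + 12) + 2 + (n * 24 + 2) + 1) + 1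
      + (n * (4 * K + 12) + 2)) ≤ 4 * (M * M) + 2 +
      (2 * (M * M) * (n * (4 * (M * M) + 12) + 2 + (n * 24 + 2) + 1) + 1
        + (n * (4 * (M * M) + 12) + 2)) := by gcongr
  refine Spec.mono (Spec.seq (spec_draw hR.bits) (E' := fun τ f =>
    chain (fun _ x (f : (Fin n → ℝ) → ℝ) => ext (roundDown (useful I.g a ρ) (2 ^ K) x) fun R =>
          f (ascend I.g a p (1 / (scale I.g a ρ * M)) x R)) 0 τ (fun _ => 0)
          fun x => ext (roundDown (useful I.g a ρ) (2 ^ K) x) f)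
    (t' := 2 ^ K * (n * (4 * K + 12) + 2 + (n * 24 + 2) + 1) + 1 + (n * (4 * K + 12) + 2)) ?_)
    htime fun f => by rw [ascentMean, hTK, hT]
  rintro τ σ₆ ⟨hτ, er, es, h7, ej⟩
  have hR' : Ready I ρ p K (1 / (scale I.g a ρ * M)) (useful I.g a ρ) (fun _ => 0) σ₆ :=
    hR.congr (fun j hj => ej j (by rintro rfl; simp at hj) (by rintro rfl; simp at hj))
      (by simp [er]) (by rw [es]) (by rw [es]) (by rw [er]; exact hR.vec)
  refine (spec_ascent_loop ha hp0 hp1 hR' (fun _ => le_rfl) (fun _ => hp0) h7).mono ?_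
    fun f => le_rfl
  gcongr

theorem ascent_value_ge {c : ℕ} {ρ p : ℚ} {b : ℝ} (hρ0 : (0 : ℝ) ≤ ρ) (hρ1 : (ρ : ℝ) ≤ 1)
    (hp0 : (0 : ℝ) < p) (hp1 : (p : ℝ) ≤ 1) (hρp : (ρ : ℝ) < (1 - p) / (1 + p)) (hb0 : 0 ≤ b)
    (hbp : b < p) (hc : 5 * (3 / ((1 - (p : ℝ)) / (1 + p) - ρ) + 1) / (p - b) ≤ c)
    (I : Inst n) (S : Finset (Fin n)) :
    b * (ρ * I.g S + I.l S) ≤ (ascent c ρ p).expectedValue I := by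
  obtain ⟨a, ha⟩ := I.l_linear
  have hc0 : 0 < c := by
    have h1 : 0 < (1 - (p : ℝ)) / (1 + p) - ρ := sub_pos.2 hρp
    have h2 : 0 < (p : ℝ) - b := sub_pos.2 hbp
    have : (0 : ℝ) < c := lt_of_lt_of_le (by positivity) hc
    exact_mod_cast this
  set M := c * (n + 1) * (n + 1) with hM
  set T := 2 ^ (Nat.log 2 (M * M) + 1) with hT
  have hMT : M * M ≤ T := (Nat.lt_pow_succ_log_self (by norm_num) _).le
  have hmain := average_ascentValue_ge I.g_submodular I.g_nonneg hρ0 hρ1 hp0 hp1 hρp hb0 hbp hc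
    (a := a) hMT S
  rw [expectedValue_eq_wp, ha S]
  refine hmain.trans ?_
  have hs := (spec_ascent (I := I) (a := a) (ρ := ρ) ha hc0 hp0.le hp1 hM hT).mean
    (fun σ => I.g (σ.set 0) + I.l (σ.set 0)) (objective I.g a) (by
      rintro R σ' rfl
      rw [objective, ha])
  simpa only [ascentMean, chain_ascentValue] using hs

end

/-! ### Polynomial time and the theorem -/

theorem timeBound_polynomial (c : ℕ) :
    ∃ q : Polynomial ℕ, ∀ n, timeBound n (c * (n + 1) * (n + 1)) = q.eval n := by
  let X : Polynomial ℕ := Polynomial.X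
  let M : Polynomial ℕ := Polynomial.C c * (X + 1) * (X + 1)
  refine ⟨10 + ((((X + 1) * ((X + 1) * 2 + 1 + 1) + 1) + ((M * 2 + 1) + (M * M * 4 + 1))) + (1 +
    ((X * 15 + 2) + (4 + ((4 * (M * M) + 2) +
      (2 * (M * M) * (X * (4 * (M * M) + 12) + 2 + (X * 24 + 2) + 1) + 1
        + (X * (4 * (M * M) + 12) + 2))))))), fun n => ?_⟩
  simp [timeBound, X, M]

theorem ascent_isPolynomialTime {c : ℕ} (hc : 0 < c) {ρ p : ℚ} (hp0 : (0 : ℝ) ≤ p)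
    (hp1 : (p : ℝ) ≤ 1) : (ascent c ρ p).IsPolynomialTime := by
  obtain ⟨q, hq⟩ := timeBound_polynomial c
  refine ⟨q, fun n I r hr => ?_⟩
  obtain ⟨a, ha⟩ := I.l_linear
  rw [← hq]
  exact ((spec_ascent (I := I) ha hc hp0 hp1 rfl rfl).time r hr).1

end RUSM
end

theorem theorem2 (β : ℝ) (hβ : 0 < β) (hβ' : β ≤ 1)
    (ε : ℝ) (hε : 0 < ε) (hε' : ε < RUSM.alpha β) :
    ∃ P : RUSM.Program,
      P.IsPolynomialTime ∧ P.IsApproximation (RUSM.alpha β - ε) (β - ε) := by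
  have h1β : 0 < 1 + β := by linarith
  have hα : RUSM.alpha β = β * ((1 - β) / (1 + β)) := by rw [RUSM.alpha, mul_div_assoc]
  have hq1 : (1 - β) / (1 + β) < 1 := by rw [div_lt_one h1β]; linarith
  have hb : 0 < β - ε := by nlinarith
  have hq0 : 0 ≤ (1 - β) / (1 + β) := div_nonneg (by linarith) h1β.le
  obtain ⟨p, hbp, hpβ⟩ := exists_rat_btwn (show β - ε < β by linarith)
  have hp0 : (0 : ℝ) < p := hb.trans hbp
  have hp1 : (p : ℝ) ≤ 1 := hpβ.le.trans hβ'
  have hratio : (RUSM.alpha β - ε) / (β - ε) < (1 - p) / (1 + p) := by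
    have h1 : (RUSM.alpha β - ε) / (β - ε) < (1 - β) / (1 + β) := by
      rw [div_lt_iff₀ hb, hα]
      nlinarith
    refine h1.trans_le ?_
    rw [div_le_div_iff₀ h1β (by linarith)]
    nlinarith
  obtain ⟨ρ, hρ, hρp⟩ := exists_rat_btwn hratio
  have hρ0 : (0 : ℝ) ≤ ρ := (div_nonneg (by linarith) hb.le).trans hρ.le
  have hρ1 : (ρ : ℝ) ≤ 1 := hρp.le.trans (by rw [div_le_one (by linarith)]; linarith)
  obtain ⟨c, hc⟩ := exists_nat_ge
    (5 * (3 / ((1 - (p : ℝ)) / (1 + p) - ρ) + 1) / (p - (β - ε)))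
  have hc0 : 0 < c := by
    have h1 : 0 < (1 - (p : ℝ)) / (1 + p) - ρ := sub_pos.2 hρp
    have h2 : 0 < (p : ℝ) - (β - ε) := sub_pos.2 hbp
    have : (0 : ℝ) < c := lt_of_lt_of_le (by positivity) hc
    exact_mod_cast this
  refine ⟨RUSM.ascent c ρ p, RUSM.ascent_isPolynomialTime hc0 hp0.le hp1, fun n I => ?_⟩
  refine Finset.sup'_le _ _ fun S _ => ?_
  refine le_trans ?_ (RUSM.ascent_value_ge hρ0 hρ1 hp0 hp1 hρp hb.le hbp hc I S)
  rw [div_lt_iff₀ hb] at hρ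
  have := mul_le_mul_of_nonneg_right hρ.le (I.g_nonneg S)
  linarith
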